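/- Let $M$ be a smooth manifold (finite-dimensional, Hausdorff, second countable, without boundary) and let $(L,\Phi)$ be a Jacobi algebroid over $M$: a smooth vector bundle $\pi:L\to M$ of finite rank with a Lie bracket $[\cdot,\cdot]$ on $\Gamma(L)$, a bundle map $a:L\to TM$ (the anchor) with $[s,ft]=f[s,t]+(a(s)f)\,t$, and a section $\Phi$ of $L^*$ with $d\Phi=0$, where $d\Phi(s,t)=a(s)(\Phi(t))-a(t)(\Phi(s))-\Phi([s,t])$. Let $\mathcal A(L)=\bigoplus_{x\ge -1}\mathcal A^x(L)$, $\mathcal A^x(L)=\Gamma(\bigwedge^{x+1}L)$, and let $i_\Phi$ be the contraction, $i_\Phi(s\wedge Y)=\Phi(s)Y-s\wedge i_\Phi Y$ for $s\in\Gamma(L)$. The Schouten–Nijenhuis bracket $[\cdot,\cdot]^{SN}$ on $\mathcal A(L)$ is the graded Lie bracket which extends the bracket of sections, with $[s,f]^{SN}=a(s)f$ and $[X,Y\wedge Z]^{SN}=[X,Y]^{SN}\wedge Z+(-1)^{x(y+1)}Y\wedge[X,Z]^{SN}$ for $X\in\mathcal A^x(L)$, $Y\in\mathcal A^y(L)$;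 the same symbol denotes the Schouten–Nijenhuis bracket of multivector fields on the manifold $L$. The Schouten–Jacobi bracket is $$[X,Y]^\Phi=[X,Y]^{SN}+x\,X\wedge i_\Phi Y-(-1)^x y\,i_\Phi X\wedge Y,\qquad X\in\mathcal A^x(L),\ Y\in\mathcal A^y(L).$$ For $f\in C^\infty(M)$ and $\mu\in\Gamma(L^*)$ put $d^\Phi f=df+f\Phi$ with $df(s)=a(s)f$, $d^\Phi\mu=d\mu+\Phi\wedge\mu$, and $\pounds^\Phi_s\mu=i_s d^\Phi\mu+d^\Phi(\mu(s))$ for $s\in\Gamma(L)$; $\pounds_s$ is $\pounds^\Phi_s$ for $\Phi=0$. For $\mu\in\Gamma(L^*)$ let $\iota_\mu\in C^\infty(L)$ be the fibrewise linear function $v\mapsto\langle\mu,v\rangle$. The vertical lift $X\mapsto X^v$ is the homomorphism of $\mathcal A(L)$ into the Grassmann algebra of multivector fields on $L$ for which $f^v=f\circ\pi$ and $s^v$ is the vertical vector field which is constant and equal to $s$ on the fibres. The complete lift $X\mapsto X^c$ is the linear map from $\mathcal A(L)$ to multivector fields on $L$ for which $f^c=\iota_{df}$, $s^c$ is the vector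 field over $a(s)$ with $s^c(\iota_\mu)=\iota_{\pounds_s\mu}$, and $(X\wedge Y)^c=X^c\wedge Y^v+X^v\wedge Y^c$. Let $\nabla$ be the Liouville (Euler) vector field on $L$. The Poisson lift of $X\in\mathcal A^x(L)$ is $$X^c_\Phi=X^c-x\,\iota_\Phi X^v+\nabla\wedge(i_\Phi X)^v,$$ extended linearly to $\mathcal A(L)$. Then: (a) $f^c_\Phi=\iota_{d^\Phi f}$ for $f\in C^\infty(M)$; (b) for $X\in\Gamma(L)$ the Poisson lift $X^c_\Phi$ is a vector field on $L$ with $X^c_\Phi(\iota_\mu)=\iota_{\pounds^\Phi_X\mu}$ for all $\mu\in\Gamma(L^*)$; (c) $(X\wedge Y)^c_\Phi=X^c_\Phi\wedge Y^v+X^v\wedge Y^c_\Phi-\iota_\Phi\,(X^v\wedge Y^v)$ for $X,Y\in\mathcal A(L)$; (d) $[X^c_\Phi,Y^c_\Phi]^{SN}=([X,Y]^\Phi)^c_\Phi$ for $X,Y\in\mathcal A(L)$. -/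

import Mathlib

open scoped Manifold ContDiff Bundle Topology
open Bundle Set

set_option linter.all false

namespace Grassmann

section Extension

variable {R N B : Type*} [CommRing R] [AddCommGroup N] [Module R N] [Ring B]

/-- Extension of a ring homomorphism `φ : R → B` and a `φ`-semilinear map `g : N → B` with
`g n * g n = 0` (the values of `φ` commuting with those of `g`) to the Grassmann algebra. -/
noncomputable def liftSemi (φ : R →+* B) (g : N →+ B)
    (hg : ∀ r n, g (r • n) = φ r * g n) (hcomm : ∀ r n, φ r * g n = g n * φ r)
    (hsq : ∀ n, g n * g n = 0) : ExteriorAlgebra R N →+* B :=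
  let C : Subring B := Subring.centralizer (Set.range φ)
  let φ' : R →+* C := φ.codRestrict C (by
    rintro r _ ⟨r', rfl⟩
    rw [← map_mul, ← map_mul, mul_comm])
  letI : Algebra R C := φ'.toAlgebra' (fun r c => Subtype.ext (c.2 _ ⟨r, rfl⟩))
  let g' : N →ₗ[R] C :=
    { toFun := fun n => ⟨g n, by rintro _ ⟨r, rfl⟩; exact hcomm r n⟩
      map_add' := fun m n => Subtype.ext (map_add g m n)
      map_smul' := fun r n => Subtype.ext (hg r n) }
  C.subtype.comp (ExteriorAlgebra.lift R ⟨g', fun n => Subtype.ext (hsq n)⟩).toRingHom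

theorem liftSemi_algebraMap (φ : R →+* B) (g : N →+ B) (hg hcomm hsq) (r : R) :
    liftSemi φ g hg hcomm hsq (algebraMap R _ r) = φ r := by
  let C : Subring B := Subring.centralizer (Set.range φ)
  let φ' : R →+* C := φ.codRestrict C (by
    rintro r _ ⟨r', rfl⟩
    rw [← map_mul, ← map_mul, mul_comm])
  let : Algebra R C := φ'.toAlgebra' (fun r c => Subtype.ext (c.2 _ ⟨r, rfl⟩))
  simp only [liftSemi, RingHom.comp_apply]
  erw [AlgHom.commutes]
  rfl

theorem liftSemi_ι (φ : R →+* B) (g : N →+ B) (hg hcomm hsq) (n : N) :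
    liftSemi φ g hg hcomm hsq (ExteriorAlgebra.ι R n) = g n := by
  simp only [liftSemi, RingHom.comp_apply]
  erw [ExteriorAlgebra.lift_ι_apply]
  rfl

/-- Data on scalars and generators which extends to an `(α, β)`-derivation, that is to an additive
map `D` with `D (X * Y) = α X * D Y + D X * β Y`. -/
structure DerData (α β : ExteriorAlgebra R N →+* B) (δ : R →+ B) (g : N →+ B) : Prop where
  scalar (r s : R) : δ (r * s) = α (algebraMap R _ r) * δ s + δ r * β (algebraMap R _ s)
  left (r : R) (n : N) :
    g (r • n) = α (algebraMap R _ r) * g n + δ r * β (ExteriorAlgebra.ι R n)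
  right (r : R) (n : N) :
    g (r • n) = α (ExteriorAlgebra.ι R n) * δ r + g n * β (algebraMap R _ r)
  square (n : N) : α (ExteriorAlgebra.ι R n) * g n + g n * β (ExteriorAlgebra.ι R n) = 0

variable {α β : ExteriorAlgebra R N →+* B} {δ : R →+ B} {g : N →+ B}

/-- The ring homomorphism `X ↦ (α X, D X; 0, β X)` into triangular matrices. -/
noncomputable def derMatrix (h : DerData α β δ g) :
    ExteriorAlgebra R N →+* Matrix (Fin 2) (Fin 2) B :=
  liftSemi
    { toFun := fun r => !![α (algebraMap R _ r), δ r; 0, β (algebraMap R _ r)]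
      map_one' := by
        have h0 := h.scalar 1 1
        simp only [mul_one, map_one, one_mul] at h0
        have h1 : δ 1 = 0 := by simpa using h0
        simp [h1, Matrix.one_fin_two]
      map_mul' := fun r s => by simp [h.scalar]
      map_zero' := by ext i j; fin_cases i <;> fin_cases j <;> simp
      map_add' := fun r s => by ext i j; fin_cases i <;> fin_cases j <;> simp }
    { toFun := fun n => !![α (ExteriorAlgebra.ι R n), g n; 0, β (ExteriorAlgebra.ι R n)]
      map_zero' := by ext i j; fin_cases i <;> fin_cases j <;> simp
      map_add' := fun r s => by ext i j; fin_cases i <;> fin_cases j <;> simp }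
    (fun r n => by simp [h.left, Algebra.smul_def])
    (fun r n => by
      have h1 := (h.left r n).symm.trans (h.right r n)
      have h2 : α (algebraMap R _ r) * α (ExteriorAlgebra.ι R n)
          = α (ExteriorAlgebra.ι R n) * α (algebraMap R _ r) := by
        rw [← map_mul, ← map_mul, Algebra.commutes]
      have h3 : β (algebraMap R _ r) * β (ExteriorAlgebra.ι R n)
          = β (ExteriorAlgebra.ι R n) * β (algebraMap R _ r) := by
        rw [← map_mul, ← map_mul, Algebra.commutes]
      simp [h1, h2, h3])
    (fun n => by
      have h2 : α (ExteriorAlgebra.ι R n) * α (ExteriorAlgebra.ι R n) = 0 := by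
        rw [← map_mul, ExteriorAlgebra.ι_sq_zero, map_zero]
      have h3 : β (ExteriorAlgebra.ι R n) * β (ExteriorAlgebra.ι R n) = 0 := by
        rw [← map_mul, ExteriorAlgebra.ι_sq_zero, map_zero]
      ext i j
      fin_cases i <;> fin_cases j <;> simp [h.square, h2, h3])

/-- The `(α, β)`-derivation `D` of the Grassmann algebra with `D r = δ r` and `D n = g n`. -/
noncomputable def derExt (h : DerData α β δ g) : ExteriorAlgebra R N →+ B :=
  AddMonoidHom.mk' (fun X => derMatrix h X 0 1) (fun X Y => by simp)

theorem derMatrix_apply (h : DerData α β δ g) (X : ExteriorAlgebra R N) :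
    derMatrix h X = !![α X, derExt h X; 0, β X] := by
  have key : derMatrix h X 0 0 = α X ∧ derMatrix h X 1 0 = 0 ∧ derMatrix h X 1 1 = β X := by
    induction X using ExteriorAlgebra.induction with
    | algebraMap r => simp [derMatrix, liftSemi_algebraMap]
    | ι n => simp [derMatrix, liftSemi_ι]
    | mul X Y hX hY => simp [Matrix.mul_apply, hX, hY]
    | add X Y hX hY => simp [hX, hY]
  ext i j
  fin_cases i <;> fin_cases j <;> simp [key, derExt]

@[simp] theorem derExt_algebraMap (h : DerData α β δ g) (r : R) :
    derExt h (algebraMap R _ r) = δ r := by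
  simp [derExt, derMatrix, liftSemi_algebraMap]

@[simp] theorem derExt_ι (h : DerData α β δ g) (n : N) :
    derExt h (ExteriorAlgebra.ι R n) = g n := by
  simp [derExt, derMatrix, liftSemi_ι]

theorem derExt_mul (h : DerData α β δ g) (X Y : ExteriorAlgebra R N) :
    derExt h (X * Y) = α X * derExt h Y + derExt h X * β Y := by
  have := congrFun (congrFun (map_mul (derMatrix h) X Y) 0) 1
  rw [derMatrix_apply, derMatrix_apply, derMatrix_apply] at this
  simpa using this

theorem derExt_eq_zero (h : DerData α β δ g) (hδ : ∀ r, δ r = 0) (hg : ∀ n, g n = 0)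
    (X : ExteriorAlgebra R N) : derExt h X = 0 := by
  induction X using ExteriorAlgebra.induction with
  | algebraMap r => simp [hδ]
  | ι n => simp [hg]
  | mul X Y hX hY => simp [derExt_mul, hX, hY]
  | add X Y hX hY => simp [hX, hY]

theorem lift_derData {R N R' N' : Type*} [CommRing R] [AddCommGroup N] [Module R N]
    [CommRing R'] [AddCommGroup N'] [Module R' N']
    {v : ExteriorAlgebra R N →+* ExteriorAlgebra R' N'} {p : R →+* R'} {m : N →+ N'}
    (hp : ∀ f, v (algebraMap R _ f) = algebraMap R' _ (p f))
    (hm : ∀ s, v (ExteriorAlgebra.ι R s) = ExteriorAlgebra.ι R' (m s))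
    {δ : R →+ R'} {c : N →+ N'} (hδ : ∀ f g, δ (f * g) = p f * δ g + δ f * p g)
    (hc : ∀ f s, c (f • s) = p f • c s + δ f • m s) :
    DerData v v ((algebraMap R' (ExteriorAlgebra R' N')).toAddMonoidHom.comp δ)
      ((ExteriorAlgebra.ι R').toAddMonoidHom.comp c) where
  scalar f g := by simp [hp, hδ]
  left f s := by simp [hp, hm, hc, Algebra.smul_def]
  right f s := by simp [hp, hm, hc, Algebra.smul_def, Algebra.commutes, add_comm]
  square s := by simp [hm]

end Extension

section Operations

variable {R N : Type*} [CommRing R] [AddCommGroup N] [Module R N]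

/-- The parity automorphism of the Grassmann algebra: `(-1) ^ k` on elements of degree `k`. -/
noncomputable abbrev parity : ExteriorAlgebra R N →ₐ[R] ExteriorAlgebra R N :=
  CliffordAlgebra.involute

/-- The contraction `i_Φ` of multisections with a 1-form `Φ`, with
`i_Φ (s ∧ Y) = Φ s Y - s ∧ i_Φ Y`. -/
noncomputable abbrev contr (Φ : Module.Dual R N) : ExteriorAlgebra R N →ₗ[R] ExteriorAlgebra R N :=
  CliffordAlgebra.contractLeft Φ

theorem contr_ι_mul (Φ : Module.Dual R N) (s : N) (Y : ExteriorAlgebra R N) :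
    contr Φ (ExteriorAlgebra.ι R s * Y) = Φ s • Y - ExteriorAlgebra.ι R s * contr Φ Y :=
  CliffordAlgebra.contractLeft_ι_mul (Q := (0 : QuadraticForm R N)) (d := Φ) s Y

theorem parity_ι (s : N) : parity (ExteriorAlgebra.ι R s) = -ExteriorAlgebra.ι R s :=
  CliffordAlgebra.involute_ι _

theorem left_induction {P : ExteriorAlgebra R N → Prop}
    (hr : ∀ r : R, P (algebraMap R _ r)) (ha : ∀ X Y, P X → P Y → P (X + Y))
    (hm : ∀ (X) (s : N), P X → P (ExteriorAlgebra.ι R s * X)) (X) : P X :=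
  CliffordAlgebra.left_induction (Q := (0 : QuadraticForm R N)) hr ha (fun X s => hm X s) X

theorem parity_contr (Φ : Module.Dual R N) (Y : ExteriorAlgebra R N) :
    parity (contr Φ Y) = -contr Φ (parity Y) := by
  induction Y using left_induction with
  | hr r => simp [contr]
  | ha X Y hX hY => simp only [map_add, hX, hY, neg_add]
  | hm X s hX =>
    simp only [map_mul, map_sub, map_smul, contr_ι_mul, parity_ι, hX, neg_mul, map_neg]
    simp

theorem ι_mul_eq (s : N) (Y : ExteriorAlgebra R N) :
    ExteriorAlgebra.ι R s * Y = parity Y * ExteriorAlgebra.ι R s := by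
  induction Y using left_induction with
  | hr r => simp [parity, Algebra.commutes]
  | ha X Y hX hY => simp only [map_add, hX, hY, mul_add, add_mul]
  | hm X t hX =>
    have h := ExteriorAlgebra.ι_add_mul_swap (R := R) s t
    rw [map_mul, parity_ι, neg_mul, neg_mul, mul_assoc, ← hX, ← mul_assoc, ← mul_assoc,
      eq_neg_of_add_eq_zero_left h, neg_mul]

/-- The additive operator `X ↦ (k - 1) X` on elements `X` of exterior degree `k`: multiplication
with the degree as an element of the graded Lie algebra, where sections have degree `0` and
functions have degree `-1`. -/
noncomputable def degOp : ExteriorAlgebra R N →+ ExteriorAlgebra R N :=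
  (DirectSum.toAddMonoid fun k : ℕ =>
    ((k : ℤ) - 1) • (Submodule.subtype (⋀[R]^k N)).toAddMonoidHom).comp
    (DirectSum.decomposeAddEquiv (fun k : ℕ => ⋀[R]^k N)).toAddMonoidHom

theorem degOp_of_mem {k : ℕ} {X : ExteriorAlgebra R N} (hX : X ∈ ⋀[R]^k N) :
    degOp X = ((k : ℤ) - 1) • X := by
  lift X to ⋀[R]^k N using hX
  simp [degOp]

end Operations


/-- A skew bracket on an `R`-module with an anchor satisfying the Leibniz rule. -/
structure AnchoredBracket (R N : Type*) [CommRing R] [Algebra ℝ R] [AddCommGroup N]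
    [Module R N] where
  bracket : N →+ N →+ N
  anchor : N →ₗ[R] Derivation ℝ R R
  bracket_self : ∀ s, bracket s s = 0
  leibniz : ∀ (s t : N) (f : R), bracket s (f • t) = f • bracket s t + anchor s f • t

namespace AnchoredBracket

variable {R N : Type*} [CommRing R] [Algebra ℝ R] [AddCommGroup N] [Module R N]
  (P : AnchoredBracket R N)

theorem bracket_skew (s t : N) : P.bracket s t = -P.bracket t s := by
  have h := P.bracket_self (s + t)
  simp only [map_add, AddMonoidHom.add_apply, P.bracket_self, zero_add, add_zero] at h
  exact eq_neg_of_add_eq_zero_right h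

theorem bracket_smul_left (f : R) (s t : N) :
    P.bracket (f • s) t = f • P.bracket s t - P.anchor t f • s := by
  rw [P.bracket_skew, P.leibniz, P.bracket_skew t s]
  simp only [smul_neg, neg_add, neg_neg, sub_eq_add_neg]

/-- The differential `df` of a function: `⟨df, s⟩ = a(s)(f)`. -/
def d₀ (f : R) : Module.Dual R N where
  toFun s := P.anchor s f
  map_add' := by simp
  map_smul' := by simp

/-- The Lie derivative of multisections along a section `s`: the derivation of the Grassmann
algebra with `£_s f = a(s)(f)` and `£_s t = [s, t]`. -/
noncomputable def lieDer (s : N) : ExteriorAlgebra R N →+ ExteriorAlgebra R N :=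
  derExt (α := RingHom.id _) (β := RingHom.id _)
    (δ := (algebraMap R (ExteriorAlgebra R N)).toAddMonoidHom.comp
      (P.anchor s).toLinearMap.toAddMonoidHom)
    (g := (ExteriorAlgebra.ι R).toAddMonoidHom.comp (P.bracket s))
    { scalar := fun f g => by simp [← Algebra.commutes g]
      left := fun f t => by simp [P.leibniz, Algebra.smul_def]
      right := fun f t => by
        simp [P.leibniz, Algebra.smul_def, add_comm, Algebra.commutes]
      square := fun t => by simp }

@[simp] theorem lieDer_algebraMap (s : N) (f : R) :
    P.lieDer s (algebraMap R _ f) = algebraMap R _ (P.anchor s f) := by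
  simp [lieDer]

@[simp] theorem lieDer_ι (s t : N) :
    P.lieDer s (ExteriorAlgebra.ι R t) = ExteriorAlgebra.ι R (P.bracket s t) := by
  simp [lieDer]

theorem lieDer_mul (s : N) (X Y : ExteriorAlgebra R N) :
    P.lieDer s (X * Y) = X * P.lieDer s Y + P.lieDer s X * Y :=
  derExt_mul _ X Y

theorem lieDer_add (s t : N) (Y : ExteriorAlgebra R N) :
    P.lieDer (s + t) Y = P.lieDer s Y + P.lieDer t Y := by
  induction Y using ExteriorAlgebra.induction with
  | algebraMap r => simp
  | ι n => simp
  | mul X Y hX hY => simp only [lieDer_mul, hX, hY, mul_add, add_mul]; abel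
  | add X Y hX hY => simp only [map_add, hX, hY]; abel

theorem lieDer_smul (f : R) (s : N) (Y : ExteriorAlgebra R N) :
    P.lieDer (f • s) Y = f • P.lieDer s Y - ExteriorAlgebra.ι R s * contr (P.d₀ f) Y := by
  induction Y using left_induction with
  | hr r => simp [contr, Algebra.smul_def]
  | ha X Y hX hY => simp only [map_add, hX, hY, smul_add, mul_add]; abel
  | hm X t hX =>
    have h := ExteriorAlgebra.ι_add_mul_swap (R := R) s t
    rw [lieDer_mul, lieDer_mul, lieDer_ι, lieDer_ι, hX, contr_ι_mul, bracket_smul_left]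
    have h2 : (P.d₀ f) t = P.anchor t f := rfl
    rw [h2, map_sub, map_smul, map_smul, mul_sub, mul_sub, ← mul_assoc, ← mul_assoc,
      eq_neg_of_add_eq_zero_left h]
    simp only [sub_mul, smul_add, smul_mul_assoc, mul_smul_comm, neg_mul]
    abel

theorem parity_lieDer (s : N) (Y : ExteriorAlgebra R N) :
    parity (P.lieDer s Y) = P.lieDer s (parity Y) := by
  induction Y using ExteriorAlgebra.induction with
  | algebraMap r => simp [parity]
  | ι n => simp
  | mul X Y hX hY => simp only [map_mul, map_add, lieDer_mul, hX, hY]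
  | add X Y hX hY => simp only [map_add, hX, hY]

theorem d₀_mul (f g : R) : P.d₀ (f * g) = f • P.d₀ g + g • P.d₀ f := by
  ext s; simp [d₀]

theorem d₀_add (f g : R) : P.d₀ (f + g) = P.d₀ f + P.d₀ g := by
  ext s; simp [d₀]

/-- `[f, Y] = -i_{df} Y` as an additive function of `f`. -/
noncomputable def scalarBracket (Y : ExteriorAlgebra R N) : R →+ ExteriorAlgebra R N :=
  AddMonoidHom.mk' (fun f => -contr (P.d₀ f) Y)
    (fun f g => by simp [contr, d₀_add, map_add, add_comm])

/-- `[s, Y] = £_s Y` as an additive function of `s`. -/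
noncomputable def sectionBracket (Y : ExteriorAlgebra R N) : N →+ ExteriorAlgebra R N :=
  AddMonoidHom.mk' (fun s => P.lieDer s Y) (fun s t => P.lieDer_add s t Y)

theorem odd_derData (Y : ExteriorAlgebra R N) (hY : parity Y = -Y) :
    DerData (RingHom.id _) (RingHom.id _) (P.scalarBracket Y) (P.sectionBracket Y) where
  scalar f g := by
    simp only [scalarBracket, AddMonoidHom.mk'_apply, d₀_mul, contr, map_add, map_smul,
      LinearMap.add_apply, LinearMap.smul_apply]
    simp [Algebra.smul_def, ← Algebra.commutes g, add_comm]
  left f s := by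
    have h := ι_mul_eq s (contr (P.d₀ f) Y)
    rw [parity_contr, hY, map_neg, neg_neg] at h
    simp [scalarBracket, sectionBracket, lieDer_smul, Algebra.smul_def, h, sub_eq_add_neg]
  right f s := by
    simp [scalarBracket, sectionBracket, lieDer_smul, Algebra.smul_def, sub_eq_add_neg,
      Algebra.commutes, add_comm]
  square s := by
    have h := ι_mul_eq s (P.lieDer s Y)
    rw [parity_lieDer, hY, map_neg, neg_mul] at h
    simp [sectionBracket, h]

theorem even_derData (Y : ExteriorAlgebra R N) (hY : parity Y = Y) :
    DerData (RingHom.id _) (parity : ExteriorAlgebra R N →ₐ[R] ExteriorAlgebra R N).toRingHom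
      (P.scalarBracket Y) (P.sectionBracket Y) where
  scalar f g := by
    simp only [scalarBracket, AddMonoidHom.mk'_apply, d₀_mul, contr, map_add, map_smul,
      LinearMap.add_apply, LinearMap.smul_apply]
    simp [Algebra.smul_def, ← Algebra.commutes g, add_comm]
  left f s := by
    have h := ι_mul_eq s (contr (P.d₀ f) Y)
    rw [parity_contr, hY, neg_mul] at h
    simp [scalarBracket, sectionBracket, lieDer_smul, Algebra.smul_def, h, sub_eq_add_neg]
  right f s := by
    simp [scalarBracket, sectionBracket, lieDer_smul, Algebra.smul_def, sub_eq_add_neg,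
      Algebra.commutes, add_comm]
  square s := by
    have h := ι_mul_eq s (P.lieDer s Y)
    rw [parity_lieDer, hY] at h
    simp [sectionBracket, h]

/-- The component of even degree. -/
noncomputable def evenPart (Y : ExteriorAlgebra R N) : ExteriorAlgebra R N :=
  algebraMap ℝ R 2⁻¹ • (Y + parity Y)

/-- The component of odd degree. -/
noncomputable def oddPart (Y : ExteriorAlgebra R N) : ExteriorAlgebra R N :=
  algebraMap ℝ R 2⁻¹ • (Y - parity Y)

theorem parity_evenPart (Y : ExteriorAlgebra R N) : parity (evenPart Y) = evenPart Y := by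
  simp [evenPart, parity, add_comm]

theorem parity_oddPart (Y : ExteriorAlgebra R N) : parity (oddPart Y) = -oddPart Y := by
  simp [oddPart, parity, ← smul_neg]

/-- The Schouten-Nijenhuis bracket on the Grassmann algebra: the bracket with `[f, Y] = -i_{df} Y`
and `[s, Y] = £_s Y` on generators which satisfies
`[X ∧ X', Y] = X ∧ [X', Y] + (-1)^(x' y) [X, Y] ∧ X'` with `X'` of exterior degree `x'` and
`Y` of exterior degree `y + 1`; so `[X, f] = X(f)` and `[X, Y]` is the given bracket on sections. -/
noncomputable def schouten (X Y : ExteriorAlgebra R N) : ExteriorAlgebra R N :=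
  derExt (P.odd_derData (oddPart Y) (parity_oddPart Y)) X
    + derExt (P.even_derData (evenPart Y) (parity_evenPart Y)) X

theorem oddPart_add_evenPart (Y : ExteriorAlgebra R N) : oddPart Y + evenPart Y = Y := by
  rw [oddPart, evenPart, ← smul_add, sub_add_add_cancel, ← two_smul R Y, smul_smul]
  have : algebraMap ℝ R 2⁻¹ * 2 = 1 := by
    rw [← map_ofNat (algebraMap ℝ R) 2, ← map_mul]; norm_num
  rw [this, one_smul]

theorem schouten_algebraMap (f : R) (Y : ExteriorAlgebra R N) :
    P.schouten (algebraMap R _ f) Y = -contr (P.d₀ f) Y := by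
  conv_rhs => rw [← oddPart_add_evenPart Y]
  simp [schouten, scalarBracket, contr, add_comm]

theorem schouten_ι (s : N) (Y : ExteriorAlgebra R N) :
    P.schouten (ExteriorAlgebra.ι R s) Y = P.lieDer s Y := by
  conv_rhs => rw [← oddPart_add_evenPart Y]
  simp [schouten, sectionBracket]

theorem schouten_mul_of_odd (X X' : ExteriorAlgebra R N) {Y : ExteriorAlgebra R N}
    (hY : parity Y = -Y) :
    P.schouten (X * X') Y = X * P.schouten X' Y + P.schouten X Y * X' := by
  have h0 : evenPart Y = 0 := by simp [evenPart, hY]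
  have h (Z) : derExt (P.even_derData (evenPart Y) (parity_evenPart Y)) Z = 0 :=
    derExt_eq_zero _ (fun r => by simp [scalarBracket, h0]) (fun s => by simp [sectionBracket, h0]) Z
  simp only [schouten, h, add_zero, derExt_mul, RingHom.id_apply]

theorem schouten_mul_of_even (X X' : ExteriorAlgebra R N) {Y : ExteriorAlgebra R N}
    (hY : parity Y = Y) :
    P.schouten (X * X') Y = X * P.schouten X' Y + P.schouten X Y * parity X' := by
  have h0 : oddPart Y = 0 := by simp [oddPart, hY]
  have h (Z) : derExt (P.odd_derData (oddPart Y) (parity_oddPart Y)) Z = 0 :=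
    derExt_eq_zero _ (fun r => by simp [scalarBracket, h0]) (fun s => by simp [sectionBracket, h0]) Z
  simp only [schouten, h, zero_add, derExt_mul, RingHom.id_apply]
  rfl

/-- A 1-form `Φ` is a 1-cocycle if `dΦ = 0`, that is
`(dΦ)(s, t) = a(s)(Φ t) - a(t)(Φ s) - Φ [s, t]` vanishes. -/
def IsCocycle (Φ : Module.Dual R N) : Prop :=
  ∀ s t, P.anchor s (Φ t) - P.anchor t (Φ s) - Φ (P.bracket s t) = 0

/-- `d^Φ f = df + f Φ` on functions. -/
def jacobiDiff₀ (Φ : Module.Dual R N) (f : R) : Module.Dual R N := P.d₀ f + f • Φ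

/-- The operator `[s, f]^Φ = a(s)(f) + Φ(s) f`. -/
def rep (Φ : Module.Dual R N) (s : N) (f : R) : R := P.anchor s f + Φ s * f

/-- The 1-form `i_s (d^Φ μ)` for a 1-form `μ`:
`(d^Φ μ)(s, t) = [s, μ t]^Φ - [t, μ s]^Φ - μ [s, t]`. -/
def jacobiDiff₁ (Φ : Module.Dual R N) (μ : Module.Dual R N) (s : N) : Module.Dual R N where
  toFun t := P.rep Φ s (μ t) - P.rep Φ t (μ s) - μ (P.bracket s t)
  map_add' t t' := by
    simp only [rep, map_add, Derivation.add_apply, mul_add, add_mul]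
    ring
  map_smul' f t := by
    simp only [rep, map_smul, P.leibniz, map_add, Derivation.smul_apply, smul_eq_mul,
      Derivation.leibniz, RingHom.id_apply]
    ring

/-- The Lie differential `£^Φ_s μ = i_s (d^Φ μ) + d^Φ (i_s μ)` of a 1-form. -/
def jacobiLie (Φ : Module.Dual R N) (s : N) (μ : Module.Dual R N) : Module.Dual R N :=
  P.jacobiDiff₁ Φ μ s + P.jacobiDiff₀ Φ (μ s)

/-- The Schouten-Jacobi bracket `[X, Y]^Φ = [X, Y] + x X ∧ i_Φ Y - (-1)^x y i_Φ X ∧ Y` for `X`, `Y`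
of exterior degrees `x + 1`, `y + 1`. -/
noncomputable def schoutenJacobi (Φ : Module.Dual R N) (X Y : ExteriorAlgebra R N) :
    ExteriorAlgebra R N :=
  P.schouten X Y + degOp X * contr Φ Y - parity (contr Φ X) * degOp Y

end AnchoredBracket

end Grassmann

namespace Algebroid

open Grassmann

variable {E H M F : Type*} [NormedAddCommGroup E] [NormedSpace ℝ E]
  [TopologicalSpace H] {I : ModelWithCorners ℝ E H} [TopologicalSpace M] [ChartedSpace H M]
  [NormedAddCommGroup F] [NormedSpace ℝ F] {V : M → Type*}
  [TopologicalSpace (TotalSpace F V)] [∀ x, TopologicalSpace (V x)] [FiberBundle F V]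
  [∀ x, AddCommGroup (V x)] [∀ x, Module ℝ (V x)] [VectorBundle ℝ F V]

/-- Smooth sections form a module over the smooth functions, pointwise. -/
noncomputable instance sectionModule :
    Module C^∞⟮I, M; 𝓘(ℝ, ℝ), ℝ⟯ Cₛ^∞⟮I; F, V⟯ where
  smul f s := ⟨fun x => f x • s x, f.contMDiff.smul_section s.contMDiff⟩
  one_smul s := ContMDiffSection.ext fun x => one_smul ℝ (s x)
  mul_smul f g s := ContMDiffSection.ext fun x => mul_smul (f x) (g x) (s x)
  smul_zero f := ContMDiffSection.ext fun x => smul_zero (f x)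
  zero_smul s := ContMDiffSection.ext fun x => zero_smul ℝ (s x)
  smul_add f s t := ContMDiffSection.ext fun x => smul_add (f x) (s x) (t x)
  add_smul f g s := ContMDiffSection.ext fun x => add_smul (f x) (g x) (s x)

@[simp] theorem smul_apply (f : C^∞⟮I, M; 𝓘(ℝ, ℝ), ℝ⟯) (s : Cₛ^∞⟮I; F, V⟯) (x : M) :
    (f • s) x = f x • s x := rfl

/-- Smooth vector fields: smooth sections of the tangent bundle. -/
abbrev VF {E H : Type*} [NormedAddCommGroup E] [NormedSpace ℝ E] [TopologicalSpace H]
    (I : ModelWithCorners ℝ E H) (M : Type*) [TopologicalSpace M] [ChartedSpace H M]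
    [IsManifold I ∞ M] := Cₛ^∞⟮I; E, (TangentSpace I : M → Type _)⟯

variable [IsManifold I ∞ M]

/-- The derivative `X(f)` of a function along a vector field. -/
noncomputable def VF.act (X : VF I M) (f : C^∞⟮I, M; 𝓘(ℝ, ℝ), ℝ⟯) : C^∞⟮I, M; 𝓘(ℝ, ℝ), ℝ⟯ where
  val x := mvfderiv I f x (X x)
  property := by
    have h1 := (f.contMDiff.contMDiff_tangentMap (m := ∞) (by simp)).comp X.contMDiff
    have h2 := contMDiff_snd_tangentBundle_modelSpace (n := ∞) ℝ 𝓘(ℝ, ℝ)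
    exact h2.comp h1

theorem VF.act_apply (X : VF I M) (f : C^∞⟮I, M; 𝓘(ℝ, ℝ), ℝ⟯) (x : M) :
    X.act f x = mvfderiv I f x (X x) := rfl

/-- A vector field as a derivation of the smooth functions. -/
noncomputable def VF.toDer : VF I M →ₗ[C^∞⟮I, M; 𝓘(ℝ, ℝ), ℝ⟯]
    Derivation ℝ C^∞⟮I, M; 𝓘(ℝ, ℝ), ℝ⟯ C^∞⟮I, M; 𝓘(ℝ, ℝ), ℝ⟯ where
  toFun X := Derivation.mk'
    { toFun := X.act
      map_add' := fun f g => by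
        ext x
        exact congrArg (fun L => L (X x)) (mvfderiv_add f.mdifferentiableAt g.mdifferentiableAt)
      map_smul' := fun c f => by
        ext x
        have h := congrArg (fun L => L (X x)) (mvfderiv_smul (a := fun _ : M => c)
          (mdifferentiableAt_const (x := x) (I := I) (I' := 𝓘(ℝ, ℝ))) (f.mdifferentiableAt (x := x)))
        simp only [mvfderiv_const] at h
        exact (by simpa using h : mvfderiv I ((fun _ : M => c) * ⇑f) x (X x)
          = c * mvfderiv I f x (X x)) }
    (fun f g => by 
      ext x
      have h := congrArg (fun L => L (X x)) (mvfderiv_mul (f.mdifferentiableAt (x := x)) (g.mdifferentiableAt (x := x)))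
      simpa [VF.act_apply] using h)
  map_add' X Y := by ext f x; exact map_add (mvfderiv I f x) (X x) (Y x)
  map_smul' c X := by ext f x; exact map_smul (mvfderiv I f x) (c x) (X x)


/-- A Lie algebroid structure on the vector bundle `V`: a Lie bracket on smooth sections and an
anchor, linear over functions (that is, a bundle map to the tangent bundle), with the Leibniz
rule. -/
structure LieAlgebroid (I : ModelWithCorners ℝ E H) (F : Type*) [NormedAddCommGroup F]
    [NormedSpace ℝ F] (V : M → Type*) [TopologicalSpace (TotalSpace F V)]
    [∀ x, TopologicalSpace (V x)] [FiberBundle F V] [∀ x, AddCommGroup (V x)]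
    [∀ x, Module ℝ (V x)] [VectorBundle ℝ F V] [IsManifold I ∞ M] where
  bracket : Cₛ^∞⟮I; F, V⟯ →ₗ[ℝ] Cₛ^∞⟮I; F, V⟯ →ₗ[ℝ] Cₛ^∞⟮I; F, V⟯
  anchor : Cₛ^∞⟮I; F, V⟯ →ₗ[C^∞⟮I, M; 𝓘(ℝ, ℝ), ℝ⟯] VF I M
  bracket_self : ∀ s, bracket s s = 0
  jacobi : ∀ s t u, bracket s (bracket t u) = bracket (bracket s t) u + bracket t (bracket s u)
  leibniz : ∀ (s t : Cₛ^∞⟮I; F, V⟯) (f : C^∞⟮I, M; 𝓘(ℝ, ℝ), ℝ⟯),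
    bracket s (f • t) = f • bracket s t + (anchor s).act f • t

/-- The bracket and the anchor of a Lie algebroid, the anchor acting on functions. -/
noncomputable def LieAlgebroid.toAnchoredBracket (A : LieAlgebroid I F V) :
    AnchoredBracket C^∞⟮I, M; 𝓘(ℝ, ℝ), ℝ⟯ Cₛ^∞⟮I; F, V⟯ where
  bracket := AddMonoidHom.mk' (fun s => (A.bracket s).toAddMonoidHom)
    (fun s t => by ext u; simp)
  anchor := VF.toDer ∘ₗ A.anchor
  bracket_self := A.bracket_self
  leibniz := A.leibniz

/-- The Grassmann algebra `𝒜(L) = ⨁ₖ Γ(⋀ᵏ L)` of multisections of a vector bundle, as the exterior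
algebra of the module `Γ(L)` over the smooth functions. -/
abbrev MultiSection {E H M : Type*} [NormedAddCommGroup E] [NormedSpace ℝ E]
    [TopologicalSpace H] (I : ModelWithCorners ℝ E H) [TopologicalSpace M] [ChartedSpace H M]
    (F : Type*) [NormedAddCommGroup F] [NormedSpace ℝ F] (V : M → Type*)
    [TopologicalSpace (TotalSpace F V)] [∀ x, TopologicalSpace (V x)] [FiberBundle F V]
    [∀ x, AddCommGroup (V x)] [∀ x, Module ℝ (V x)] [VectorBundle ℝ F V] :=
  ExteriorAlgebra C^∞⟮I, M; 𝓘(ℝ, ℝ), ℝ⟯ Cₛ^∞⟮I; F, V⟯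

/-- 1-forms, the sections of the dual bundle: linear functionals on `Γ(L)` over the smooth
functions. -/
abbrev Form {E H M : Type*} [NormedAddCommGroup E] [NormedSpace ℝ E]
    [TopologicalSpace H] (I : ModelWithCorners ℝ E H) [TopologicalSpace M] [ChartedSpace H M]
    (F : Type*) [NormedAddCommGroup F] [NormedSpace ℝ F] (V : M → Type*)
    [TopologicalSpace (TotalSpace F V)] [∀ x, TopologicalSpace (V x)] [FiberBundle F V]
    [∀ x, AddCommGroup (V x)] [∀ x, Module ℝ (V x)] [VectorBundle ℝ F V] :=
  Module.Dual C^∞⟮I, M; 𝓘(ℝ, ℝ), ℝ⟯ Cₛ^∞⟮I; F, V⟯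

/-- Multivector fields on a manifold: the Grassmann algebra of the module of vector fields. -/
abbrev MultiVector {E H : Type*} [NormedAddCommGroup E] [NormedSpace ℝ E] [TopologicalSpace H]
    (I : ModelWithCorners ℝ E H) (M : Type*) [TopologicalSpace M] [ChartedSpace H M]
    [IsManifold I ∞ M] :=
  ExteriorAlgebra C^∞⟮I, M; 𝓘(ℝ, ℝ), ℝ⟯ (VF I M)

/-- A Jacobi algebroid: a Lie algebroid with a closed 1-form `Φ` (a 1-cocycle). -/
structure JacobiAlgebroid {E H M : Type*} [NormedAddCommGroup E] [NormedSpace ℝ E]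
    [TopologicalSpace H] [TopologicalSpace M] [ChartedSpace H M]
    (I : ModelWithCorners ℝ E H) (F : Type*) [NormedAddCommGroup F] [NormedSpace ℝ F]
    (V : M → Type*) [TopologicalSpace (TotalSpace F V)] [∀ x, TopologicalSpace (V x)]
    [FiberBundle F V] [∀ x, AddCommGroup (V x)] [∀ x, Module ℝ (V x)] [VectorBundle ℝ F V]
    [IsManifold I ∞ M] extends LieAlgebroid I F V where
  Φ : Form I F V
  isCocycle : toLieAlgebroid.toAnchoredBracket.IsCocycle Φ

section TangentAlgebroid

variable [FiniteDimensional ℝ E]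

theorem VF.contMDiff_bracket (X Y : VF I M) :
    ContMDiff I (I.prod 𝓘(ℝ, E)) ∞
      (fun x => TotalSpace.mk' E x (VectorField.mlieBracket I X Y x)) := by
  have : IsManifold I (((⊤ : ℕ∞) : ℕ∞ω) + 1) M := by simpa using ‹IsManifold I ∞ M›
  have : IsManifold I (minSmoothness ℝ 2) M := by
    rw [minSmoothness_of_isRCLikeNormedField]; infer_instance
  exact ContDiff.mlieBracket_vectorField (m := ⊤) (n := ⊤) X.contMDiff Y.contMDiff (by simp)

/-- The tangent bundle with the bracket of vector fields, as a Lie algebroid. -/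
noncomputable def tangentAlgebroid : LieAlgebroid I E (TangentSpace I : M → Type _) where
  bracket := LinearMap.mk₂ ℝ (fun X Y => ⟨VectorField.mlieBracket I X Y, VF.contMDiff_bracket X Y⟩)
    (fun X X' Y => ContMDiffSection.ext fun x =>
      VectorField.mlieBracket_add_left X.mdifferentiableAt X'.mdifferentiableAt)
    (fun c X Y => ContMDiffSection.ext fun x =>
      VectorField.mlieBracket_const_smul_left X.mdifferentiableAt)
    (fun X Y Y' => ContMDiffSection.ext fun x =>
      VectorField.mlieBracket_add_right Y.mdifferentiableAt Y'.mdifferentiableAt)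
    (fun c X Y => ContMDiffSection.ext fun x =>
      VectorField.mlieBracket_const_smul_right Y.mdifferentiableAt)
  anchor := LinearMap.id
  bracket_self X := ContMDiffSection.ext fun x => by simp
  jacobi X Y Z := ContMDiffSection.ext fun x => by
    have : IsManifold I (minSmoothness ℝ 3) M := by
      rw [minSmoothness_of_isRCLikeNormedField]; infer_instance
    have h : minSmoothness ℝ 2 ≤ ∞ := by
      rw [minSmoothness_of_isRCLikeNormedField]; exact WithTop.coe_le_coe.2 (le_top : (2 : ℕ∞) ≤ ⊤)
    exact VectorField.leibniz_identity_mlieBracket_apply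
      (X.contMDiff.contMDiffAt.of_le h) (Y.contMDiff.contMDiffAt.of_le h)
      (Z.contMDiff.contMDiffAt.of_le h)
  leibniz X Y f := ContMDiffSection.ext fun x => by
    have h := VectorField.mlieBracket_smul_right (V := X) (f.mdifferentiableAt (x := x))
      (Y.mdifferentiableAt (x := x))
    rw [add_comm] at h
    exact h

/-- The Schouten-Nijenhuis bracket of multivector fields. -/
noncomputable def schoutenNijenhuis (X Y : MultiVector I M) : MultiVector I M :=
  (tangentAlgebroid (I := I) (M := M)).toAnchoredBracket.schouten X Y

end TangentAlgebroid


section Frames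

variable [FiniteDimensional ℝ E] [T2Space M] [FiniteDimensional ℝ F] [ContMDiffVectorBundle ∞ F V I]

variable (I) in
theorem exists_cutoff [IsManifold I ∞ M] {U : Set M} (p : M) (hU : U ∈ 𝓝 p) :
    ∃ χ : C^∞⟮I, M; 𝓘(ℝ, ℝ), ℝ⟯, (∀ᶠ x in 𝓝 p, χ x = 1) ∧ tsupport χ ⊆ U := by
  obtain ⟨f, -, hf⟩ := (SmoothBumpFunction.nhds_basis_tsupport (I := I) p).mem_iff.1 hU
  exact ⟨⟨f, f.contMDiff⟩, f.eventuallyEq_one, hf⟩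

theorem exists_frame (p : M) : ∃ (U : Set M) (t : Fin (Module.finrank ℝ F) → Cₛ^∞⟮I; F, V⟯),
    IsOpen U ∧ p ∈ U ∧ U ⊆ (trivializationAt F V p).baseSet ∧
    (∀ x ∈ U, ∀ i, (trivializationAt F V p ⟨x, t i x⟩).2 = Module.finBasis ℝ F i) ∧
    ∀ u : Cₛ^∞⟮I; F, V⟯, ∃ g : Fin (Module.finrank ℝ F) → C^∞⟮I, M; 𝓘(ℝ, ℝ), ℝ⟯,
      ∀ x ∈ U, ∀ i, g i x
        = (Module.finBasis ℝ F).repr (trivializationAt F V p ⟨x, u x⟩).2 i := by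
  set e := trivializationAt F V p with he
  set b := Module.finBasis ℝ F with hb
  have hp : p ∈ e.baseSet := mem_baseSet_trivializationAt F V p
  obtain ⟨χ, hχ1, hχ⟩ := exists_cutoff I p (e.open_baseSet.mem_nhds hp)
  obtain ⟨U, hU1, hUo, hpU⟩ := eventually_nhds_iff.1 (hχ1.and (e.open_baseSet.mem_nhds hp))
  refine ⟨U, fun i => ⟨fun x => χ x • e.localFrame b i x,
    ContMDiffOn.smul_section_of_tsupport χ.contMDiff.contMDiffOn e.open_baseSet hχ
      (e.contMDiffOn_localFrame_baseSet ∞ b i)⟩, hUo, hpU, fun x hx => (hU1 x hx).2, ?_, ?_⟩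
  · intro x hx i
    have h1 := (hU1 x hx).1
    have h2 : x ∈ e.baseSet := (hU1 x hx).2
    change (e ⟨x, χ x • e.localFrame b i x⟩).2 = b i
    rw [h1, one_smul, e.localFrame_apply_of_mem_baseSet b h2]
    simp [Trivialization.basisAt, h2]
  · intro u
    have hsm (i) : ContMDiff I 𝓘(ℝ, ℝ) ∞ (fun x => χ x • b.repr (e ⟨x, u x⟩).2 i) := by
      intro x
      by_cases hx : x ∈ tsupport χ
      · have hxe : x ∈ e.baseSet := hχ hx
        have h1 : ContMDiffAt I 𝓘(ℝ, F) ∞ (fun x => (e ⟨x, u x⟩).2) x :=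
          (e.contMDiffAt_section_iff hxe).1 u.contMDiff.contMDiffAt
        have h2 : ContMDiff 𝓘(ℝ, F) 𝓘(ℝ, ℝ) ∞ (fun v => b.repr v i) :=
          (LinearMap.toContinuousLinearMap (b.coord i)).contMDiff
        exact χ.contMDiff.contMDiffAt.smul (h2.contMDiffAt.comp x h1)
      · have : (fun x => χ x • b.repr (e ⟨x, u x⟩).2 i) =ᶠ[𝓝 x] fun _ => 0 := by
          filter_upwards [(isClosed_tsupport χ).isOpen_compl.mem_nhds hx] with y hy
          rw [image_eq_zero_of_notMem_tsupport hy, zero_smul]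
        exact contMDiffAt_const.congr_of_eventuallyEq this
    refine ⟨fun i => ⟨_, hsm i⟩, fun x hx i => ?_⟩
    change χ x • b.repr (e ⟨x, u x⟩).2 i = _
    rw [(hU1 x hx).1, one_smul]


theorem triv_add {e : Trivialization F (π F V)} [MemTrivializationAtlas e] {x : M}
    (hx : x ∈ e.baseSet) (v w : V x) : (e ⟨x, v + w⟩).2 = (e ⟨x, v⟩).2 + (e ⟨x, w⟩).2 :=
  (e.linear ℝ hx).map_add v w

theorem triv_smul {e : Trivialization F (π F V)} [MemTrivializationAtlas e] {x : M}
    (hx : x ∈ e.baseSet) (c : ℝ) (v : V x) : (e ⟨x, c • v⟩).2 = c • (e ⟨x, v⟩).2 :=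
  (e.linear ℝ hx).map_smul c v

theorem triv_sum {e : Trivialization F (π F V)} [MemTrivializationAtlas e] {x : M}
    (hx : x ∈ e.baseSet) {ι : Type*} (A : Finset ι) (v : ι → V x) :
    (e ⟨x, ∑ i ∈ A, v i⟩).2 = ∑ i ∈ A, (e ⟨x, v i⟩).2 :=
  map_sum (IsLinearMap.mk' _ (e.linear ℝ hx)) v A

theorem triv_inj {e : Trivialization F (π F V)} [MemTrivializationAtlas e] {x : M}
    (hx : x ∈ e.baseSet) {v w : V x} (h : (e ⟨x, v⟩).2 = (e ⟨x, w⟩).2) : v = w :=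
  (e.linearEquivAt ℝ x hx).injective h

theorem sum_apply {ι : Type*} (A : Finset ι) (f : ι → Cₛ^∞⟮I; F, V⟯) (x : M) :
    (∑ i ∈ A, f i) x = ∑ i ∈ A, f i x :=
  map_sum ((Pi.evalAddMonoidHom V x).comp (ContMDiffSection.coeAddHom I F ∞ V)) f A

theorem exists_section_through (q : TotalSpace F V) : ∃ u : Cₛ^∞⟮I; F, V⟯, u q.proj = q.2 := by
  obtain ⟨U, t, hU, hp, hUe, ht, -⟩ := exists_frame (I := I) (V := V) (F := F) q.proj
  set e := trivializationAt F V q.proj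
  refine ⟨∑ i, ((Module.finBasis ℝ F).repr (e q).2 i) • t i, triv_inj (hUe hp) ?_⟩
  rw [sum_apply, triv_sum (hUe hp)]
  simp only [ContMDiffSection.coe_smul, Pi.smul_apply, triv_smul (hUe hp), ht _ hp]
  exact (Module.finBasis ℝ F).sum_repr _

variable (I) in
/-- A smooth section of the bundle through a given point of its total space. -/
noncomputable def sectionThrough (q : TotalSpace F V) : Cₛ^∞⟮I; F, V⟯ :=
  (exists_section_through q).choose

theorem sectionThrough_apply (q : TotalSpace F V) : sectionThrough I q q.proj = q.2 :=
  (exists_section_through q).choose_spec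

theorem dual_local (μ : Module.Dual C^∞⟮I, M; 𝓘(ℝ, ℝ), ℝ⟯ Cₛ^∞⟮I; F, V⟯) {u u' : Cₛ^∞⟮I; F, V⟯}
    {U : Set M} (hU : IsOpen U) {x : M} (hx : x ∈ U) (h : ∀ y ∈ U, u y = u' y) :
    μ u x = μ u' x := by
  obtain ⟨χ, hχ1, hχ⟩ := exists_cutoff I x (hU.mem_nhds hx)
  have h0 : χ • u = χ • u' := ContMDiffSection.ext fun y => by
    by_cases hy : y ∈ U
    · simp [h y hy]
    · have : χ y = 0 := image_eq_zero_of_notMem_tsupport fun h' => hy (hχ h')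
      simp [this]
  have h1 := congrArg (fun v => μ v x) h0
  simpa [hχ1.self_of_nhds] using h1

theorem bracket_local (A : LieAlgebroid I F V) (s : Cₛ^∞⟮I; F, V⟯) {u u' : Cₛ^∞⟮I; F, V⟯}
    {U : Set M} (hU : IsOpen U) {x : M} (hx : x ∈ U) (h : ∀ y ∈ U, u y = u' y) :
    A.bracket s u x = A.bracket s u' x := by
  obtain ⟨χ, hχ1, hχ⟩ := exists_cutoff I x (hU.mem_nhds hx)
  have h0 : χ • u = χ • u' := ContMDiffSection.ext fun y => by
    by_cases hy : y ∈ U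
    · simp [h y hy]
    · have : χ y = 0 := image_eq_zero_of_notMem_tsupport fun h' => hy (hχ h')
      simp [this]
  have h1 := congrArg (fun v => A.bracket s v x) h0
  simpa [A.leibniz, hχ1.self_of_nhds, h x hx] using h1

theorem dual_formula (μ : Module.Dual C^∞⟮I, M; 𝓘(ℝ, ℝ), ℝ⟯ Cₛ^∞⟮I; F, V⟯)
    {e : Trivialization F (π F V)} [MemTrivializationAtlas e]
    {ι : Type*} [Fintype ι] (b : Module.Basis ι ℝ F) {U : Set M} (hU : IsOpen U) (hUe : U ⊆ e.baseSet)
    {t : ι → Cₛ^∞⟮I; F, V⟯} (ht : ∀ x ∈ U, ∀ i, (e ⟨x, t i x⟩).2 = b i)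
    {u : Cₛ^∞⟮I; F, V⟯} {g : ι → C^∞⟮I, M; 𝓘(ℝ, ℝ), ℝ⟯}
    (hg : ∀ x ∈ U, ∀ i, g i x = b.repr (e ⟨x, u x⟩).2 i) {x : M} (hx : x ∈ U) :
    μ u x = ∑ i, b.repr (e ⟨x, u x⟩).2 i * μ (t i) x := by
  have h1 : μ u x = μ (∑ i, g i • t i) x := by
    refine dual_local μ hU hx fun y hy => triv_inj (hUe hy) ?_
    rw [sum_apply, triv_sum (hUe hy)]
    simp only [smul_apply, triv_smul (hUe hy), ht _ hy, hg y hy]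
    exact (b.sum_repr _).symm
  rw [h1, map_sum]
  have h2 (A : Finset ι) (f : ι → C^∞⟮I, M; 𝓘(ℝ, ℝ), ℝ⟯) : (∑ i ∈ A, f i) x = ∑ i ∈ A, f i x :=
    map_sum (ContMDiffMap.evalRingHom x) f A
  rw [h2]
  simp [hg x hx]

theorem bracket_formula (A : LieAlgebroid I F V) (s : Cₛ^∞⟮I; F, V⟯)
    {e : Trivialization F (π F V)} [MemTrivializationAtlas e]
    {ι : Type*} [Fintype ι] (b : Module.Basis ι ℝ F) {U : Set M} (hU : IsOpen U) (hUe : U ⊆ e.baseSet)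
    {t : ι → Cₛ^∞⟮I; F, V⟯} (ht : ∀ x ∈ U, ∀ i, (e ⟨x, t i x⟩).2 = b i)
    {u : Cₛ^∞⟮I; F, V⟯} {g : ι → C^∞⟮I, M; 𝓘(ℝ, ℝ), ℝ⟯}
    (hg : ∀ x ∈ U, ∀ i, g i x = b.repr (e ⟨x, u x⟩).2 i) {x : M} (hx : x ∈ U) :
    (e ⟨x, A.bracket s u x⟩).2 = ∑ i, (b.repr (e ⟨x, u x⟩).2 i • (e ⟨x, A.bracket s (t i) x⟩).2
      + mvfderiv I (g i) x (A.anchor s x) • b i) := by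
  have h1 : A.bracket s u x = A.bracket s (∑ i, g i • t i) x := by
    refine bracket_local A s hU hx fun y hy => triv_inj (hUe hy) ?_
    rw [sum_apply, triv_sum (hUe hy)]
    simp only [smul_apply, triv_smul (hUe hy), ht _ hy, hg y hy]
    exact (b.sum_repr _).symm
  rw [h1, map_sum, sum_apply, triv_sum (hUe hx)]
  refine Finset.sum_congr rfl fun i _ => ?_
  rw [A.leibniz, ContMDiffSection.coe_add, Pi.add_apply, triv_add (hUe hx), smul_apply,
    smul_apply, triv_smul (hUe hx), triv_smul (hUe hx), hg x hx, ht x hx]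
  rfl


variable (F V) in
/-- The pull-back `f ∘ π` of a function to the total space of the bundle. -/
noncomputable def pullback : C^∞⟮I, M; 𝓘(ℝ, ℝ), ℝ⟯ →+*
    C^∞⟮I.prod 𝓘(ℝ, F), TotalSpace F V; 𝓘(ℝ, ℝ), ℝ⟯ where
  toFun f := ⟨fun q => f q.proj, f.contMDiff.comp (contMDiff_proj V)⟩
  map_one' := rfl
  map_mul' _ _ := rfl
  map_zero' := rfl
  map_add' _ _ := rfl

theorem contMDiffAt_coord {e : Trivialization F (π F V)} [MemTrivializationAtlas e]
    (b : Module.Basis (Fin (Module.finrank ℝ F)) ℝ F) {q : TotalSpace F V}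
    (hq : q.proj ∈ e.baseSet) (i) :
    ContMDiffAt (I.prod 𝓘(ℝ, F)) 𝓘(ℝ, ℝ) ∞ (fun q' => b.repr (e q').2 i) q := by
  have h1 : ContMDiffAt (I.prod 𝓘(ℝ, F)) 𝓘(ℝ, F) ∞ (fun q' => (e q').2) q :=
    ((e.contMDiffAt_iff (e.mem_source.2 hq)).1 contMDiffAt_id).2
  have h2 : ContMDiff 𝓘(ℝ, F) 𝓘(ℝ, ℝ) ∞ (fun v => b.repr v i) :=
    (LinearMap.toContinuousLinearMap (b.coord i)).contMDiff
  exact h2.contMDiffAt.comp q h1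

/-- The linear function `ι_μ` on the total space of the bundle defined by a 1-form `μ`:
`ι_μ (v) = ⟨μ, v⟩`, the value at the base point of `v` of `μ u` for a section `u` through `v`. -/
noncomputable def linFun (μ : Module.Dual C^∞⟮I, M; 𝓘(ℝ, ℝ), ℝ⟯ Cₛ^∞⟮I; F, V⟯) :
    C^∞⟮I.prod 𝓘(ℝ, F), TotalSpace F V; 𝓘(ℝ, ℝ), ℝ⟯ where
  val q := μ (sectionThrough I q) q.proj
  property q₀ := by
    obtain ⟨U, t, hU, hp, hUe, ht, hg⟩ := exists_frame (I := I) (V := V) (F := F) q₀.proj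
    have h1 : (fun q : TotalSpace F V => μ (sectionThrough I q) q.proj) =ᶠ[𝓝 q₀]
        fun q => ∑ i, (Module.finBasis ℝ F).repr (trivializationAt F V q₀.proj q).2 i
          * μ (t i) q.proj := by
      filter_upwards [(FiberBundle.continuous_proj F V).continuousAt.preimage_mem_nhds
        (hU.mem_nhds hp)] with q hq
      obtain ⟨g, hg⟩ := hg (sectionThrough I q)
      rw [dual_formula μ _ hU hUe ht hg hq, sectionThrough_apply]
    refine ContMDiffAt.congr_of_eventuallyEq ?_ h1
    refine ContMDiffAt.sum fun i _ => ?_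
    exact (contMDiffAt_coord _ (hUe hp) i).mul
      ((μ (t i)).contMDiff.contMDiffAt.comp q₀ (contMDiff_proj V).contMDiffAt)

/-- The function `ι_μ` may be computed with any section through the given point. -/
theorem linFun_apply (μ : Module.Dual C^∞⟮I, M; 𝓘(ℝ, ℝ), ℝ⟯ Cₛ^∞⟮I; F, V⟯)
    (q : TotalSpace F V) (u : Cₛ^∞⟮I; F, V⟯) (hu : u q.proj = q.2) :
    linFun μ q = μ u q.proj := by
  obtain ⟨U, t, hU, hp, hUe, ht, hg⟩ := exists_frame (I := I) (V := V) (F := F) q.proj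
  obtain ⟨g, hg1⟩ := hg u
  obtain ⟨g', hg2⟩ := hg (sectionThrough I q)
  change μ (sectionThrough I q) q.proj = _
  rw [dual_formula μ _ hU hUe ht hg1 hp, dual_formula μ _ hU hUe ht hg2 hp,
    sectionThrough_apply, hu]

variable (I) in
/-- The vertical vector at `q` given by `w`: the velocity at `τ = 0` of `τ ↦ q + τ w`. -/
noncomputable def vert (q : TotalSpace F V) (w : V q.proj) :
    TangentSpace (I.prod 𝓘(ℝ, F)) q :=
  mfderiv 𝓘(ℝ, ℝ) (I.prod 𝓘(ℝ, F)) (fun τ : ℝ => (⟨q.proj, q.2 + τ • w⟩ : TotalSpace F V)) 0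
    (1 : ℝ)

variable (I) in
/-- The tangent vector of the total space with the components `v`, `w` in the trivialization `e`, at
the point with the coordinates `z`. -/
noncomputable def tri (e : Trivialization F (π F V)) (z : M × F) (v : E) (w : F) : E × F :=
  mfderiv (I.prod 𝓘(ℝ, F)) (I.prod 𝓘(ℝ, F)) e.toOpenPartialHomeomorph.symm z ((v, w) : E × F)

theorem mdiff_symm (e : Trivialization F (π F V)) [MemTrivializationAtlas e] {z : M × F}
    (hz : z.1 ∈ e.baseSet) :
    MDifferentiableAt (I.prod 𝓘(ℝ, F)) (I.prod 𝓘(ℝ, F)) e.toOpenPartialHomeomorph.symm z :=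
  ((e.contMDiffOn_symm (IB := I) (n := ∞)).contMDiffAt
    (e.open_target.mem_nhds (e.mem_target.2 hz))).mdifferentiableAt (by simp)

theorem vert_eq {e : Trivialization F (π F V)} [MemTrivializationAtlas e] {q : TotalSpace F V}
    (hq : q.proj ∈ e.baseSet) (w : V q.proj) :
    vert I q w = tri I e (e q) 0 (e ⟨q.proj, w⟩).2 := by
  set d := (e ⟨q.proj, w⟩).2
  have hc : (fun τ : ℝ => (⟨q.proj, q.2 + τ • w⟩ : TotalSpace F V))
      = e.toOpenPartialHomeomorph.symm ∘ fun τ : ℝ => (q.proj, (e q).2 + τ • d) := by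
    funext τ
    have h1 : e ⟨q.proj, q.2 + τ • w⟩ = (q.proj, (e q).2 + τ • d) := by
      refine Prod.ext (e.coe_fst' hq) ?_
      rw [triv_add hq, triv_smul hq]
    have h2 := e.toOpenPartialHomeomorph.left_inv
      (e.mem_source.2 (show (⟨q.proj, q.2 + τ • w⟩ : TotalSpace F V).proj ∈ e.baseSet from hq))
    exact h2.symm.trans (congrArg e.toOpenPartialHomeomorph.symm h1)
  have h0 : (q.proj, (e q).2 + (0 : ℝ) • d) = e q := by
    rw [zero_smul, add_zero]; exact Prod.ext (e.coe_fst' hq).symm rfl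
  have hd : HasMFDerivAt 𝓘(ℝ, ℝ) (I.prod 𝓘(ℝ, F)) (fun τ : ℝ => (q.proj, (e q).2 + τ • d)) 0
      ((0 : ℝ →L[ℝ] E).prod (ContinuousLinearMap.toSpanSingleton ℝ d)) := by
    refine HasMFDerivAt.prodMk (hasMFDerivAt_const _ _) ?_
    refine HasFDerivAt.hasMFDerivAt ?_
    refine HasFDerivAt.const_add _ ?_
    exact (ContinuousLinearMap.toSpanSingleton ℝ d).hasFDerivAt
  have hG : HasMFDerivAt (I.prod 𝓘(ℝ, F)) (I.prod 𝓘(ℝ, F)) e.toOpenPartialHomeomorph.symm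
      (q.proj, (e q).2 + (0 : ℝ) • d) _ := (mdiff_symm (I := I) e hq).hasMFDerivAt
  have := (hG.comp (0 : ℝ) hd).mfderiv
  have key (z : M × F) (hz : z = e q) : tri I e z 0 d = tri I e (e q) 0 d := by rw [hz]
  refine Eq.trans ?_ (key _ h0)
  unfold vert tri
  rw [hc, this]
  refine congrArg (mfderiv (I.prod 𝓘(ℝ, F)) (I.prod 𝓘(ℝ, F)) e.toOpenPartialHomeomorph.symm
    (q.proj, (e q).2 + (0 : ℝ) • d)) ?_
  exact Prod.ext rfl (one_smul ℝ d)

theorem tri_smooth {e : Trivialization F (π F V)} [MemTrivializationAtlas e] (X : VF I M)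
    {w : TotalSpace F V → F} {q₀ : TotalSpace F V} (hq : q₀.proj ∈ e.baseSet)
    (hw : ContMDiffAt (I.prod 𝓘(ℝ, F)) 𝓘(ℝ, F) ∞ w q₀) :
    ContMDiffAt (I.prod 𝓘(ℝ, F)) ((I.prod 𝓘(ℝ, F)).prod 𝓘(ℝ, E × F)) ∞
      (fun q => TotalSpace.mk' (E × F) (E := (TangentSpace (I.prod 𝓘(ℝ, F)) :
        TotalSpace F V → Type _)) q (tri I e (e q) (X q.proj) (w q))) q₀ := by
  have h1 : ContMDiffAt (I.prod 𝓘(ℝ, F)) 𝓘(ℝ, F) ∞ (fun q' => (e q').2) q₀ :=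
    ((e.contMDiffAt_iff (e.mem_source.2 hq)).1 contMDiffAt_id).2
  have h2 : ContMDiffAt (I.prod 𝓘(ℝ, F)) (𝓘(ℝ, F).prod 𝓘(ℝ, F)) ∞
      (fun q => TotalSpace.mk' F (E := (TangentSpace 𝓘(ℝ, F) : F → Type _)) (e q).2 (w q)) q₀ := by
    refine contMDiffAt_totalSpace.2 ⟨h1, ?_⟩
    simpa using hw
  have h3 : ContMDiffAt (I.prod 𝓘(ℝ, F)) (I.prod 𝓘(ℝ, E)) ∞
      (fun q : TotalSpace F V =>
        TotalSpace.mk' E (E := (TangentSpace I : M → Type _)) q.proj (X q.proj)) q₀ :=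
    X.contMDiff.contMDiffAt.comp q₀ (contMDiff_proj V).contMDiffAt
  have h4 := (contMDiff_equivTangentBundleProd_symm (I := I) (M := M) (I' := 𝓘(ℝ, F)) (M' := F)
    (n := ∞)).contMDiffAt.comp q₀ (h3.prodMk h2)
  have h5 := (e.contMDiffOn_symm (IB := I) (n := ∞)).contMDiffOn_tangentMapWithin (m := ∞) (by simp)
    e.open_target.uniqueMDiffOn
  have hz : ∀ q : TotalSpace F V, q.proj ∈ e.baseSet → e q ∈ e.target := fun q h =>
    e.mem_target.2 ((e.coe_fst' h).symm ▸ h)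
  have h6 := h5.contMDiffAt (x := (equivTangentBundleProd I M 𝓘(ℝ, F) F).symm
    (⟨q₀.proj, X q₀.proj⟩, ⟨(e q₀).2, w q₀⟩)) ((e.open_target.preimage
    (FiberBundle.continuous_proj _ _)).mem_nhds (by
      exact e.mem_target.2 hq))
  refine (h6.comp q₀ h4).congr_of_eventuallyEq ?_
  filter_upwards [(FiberBundle.continuous_proj F V).continuousAt.preimage_mem_nhds
    (e.open_baseSet.mem_nhds hq)] with q hq'
  have key (z : M × F) (hz : z.1 ∈ e.baseSet) (q' : TotalSpace F V)
      (hq' : e.toOpenPartialHomeomorph.symm z = q') (y : E × F) :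
      TotalSpace.mk' (E × F) (E := (TangentSpace (I.prod 𝓘(ℝ, F)) :
        TotalSpace F V → Type _)) q' (tri I e z y.1 y.2)
      = tangentMapWithin (I.prod 𝓘(ℝ, F)) (I.prod 𝓘(ℝ, F)) e.toOpenPartialHomeomorph.symm
        e.target ⟨z, y⟩ := by
    subst hq'
    rw [tangentMapWithin_eq_tangentMap (e.open_target.uniqueMDiffOn _ (e.mem_target.2 hz))
      (mdiff_symm e hz)]
    rfl
  have h0 : e q = (q.proj, (e q).2) := Prod.ext (e.coe_fst' hq') rfl
  have h7 := key (q.proj, (e q).2) hq' q (by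
    rw [← h0]; exact e.toOpenPartialHomeomorph.left_inv (e.mem_source.2 hq')) (X q.proj, w q)
  rw [← h0] at h7
  refine h7.trans ?_
  rw [h0]
  rfl

theorem tri_add (e : Trivialization F (π F V)) (z : M × F) (v v' : E) (w w' : F) :
    tri I e z (v + v') (w + w') = tri I e z v w + tri I e z v' w' :=
  map_add (mfderiv (I.prod 𝓘(ℝ, F)) (I.prod 𝓘(ℝ, F)) e.toOpenPartialHomeomorph.symm z)
    ((v, w) : E × F) ((v', w') : E × F)

theorem tri_smul (e : Trivialization F (π F V)) (z : M × F) (c : ℝ) (v : E) (w : F) :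
    tri I e z (c • v) (c • w) = c • tri I e z v w :=
  map_smul (mfderiv (I.prod 𝓘(ℝ, F)) (I.prod 𝓘(ℝ, F)) e.toOpenPartialHomeomorph.symm z)
    c ((v, w) : E × F)

theorem vert_add (q : TotalSpace F V) (w w' : V q.proj) :
    vert I q (w + w') = vert I q w + vert I q w' := by
  have hq := mem_baseSet_trivializationAt F V q.proj
  rw [vert_eq hq, vert_eq hq, vert_eq hq, triv_add hq]
  have := tri_add (I := I) (trivializationAt F V q.proj) (trivializationAt F V q.proj q) 0 0
    (trivializationAt F V q.proj ⟨q.proj, w⟩).2 (trivializationAt F V q.proj ⟨q.proj, w'⟩).2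
  rwa [add_zero] at this

theorem vert_smul (q : TotalSpace F V) (c : ℝ) (w : V q.proj) :
    vert I q (c • w) = c • vert I q w := by
  have hq := mem_baseSet_trivializationAt F V q.proj
  rw [vert_eq hq, vert_eq hq, triv_smul hq]
  have := tri_smul (I := I) (trivializationAt F V q.proj) (trivializationAt F V q.proj q) c 0
    (trivializationAt F V q.proj ⟨q.proj, w⟩).2
  rwa [smul_zero] at this

theorem section_deriv {e : Trivialization F (π F V)} [MemTrivializationAtlas e]
    (t : Cₛ^∞⟮I; F, V⟯) {p : M} (hp : p ∈ e.baseSet) (v : TangentSpace I p) :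
    mfderiv I (I.prod 𝓘(ℝ, F)) (fun x => TotalSpace.mk' F x (t x)) p v
      = tri I e (e ⟨p, t p⟩) v (mfderiv I 𝓘(ℝ, F) (fun x => (e ⟨x, t x⟩).2) p v) := by
  have hs : ContMDiffAt I 𝓘(ℝ, F) ∞ (fun x => (e ⟨x, t x⟩).2) p :=
    (e.contMDiffAt_section_iff hp).1 t.contMDiff.contMDiffAt
  have hd := (hasMFDerivAt_id (I := I) p).prodMk (hs.mdifferentiableAt (by simp)).hasMFDerivAt
  have h0 : e ⟨p, t p⟩ = (p, (e ⟨p, t p⟩).2) := Prod.ext (e.coe_fst' hp) rfl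
  have hc : (fun x => TotalSpace.mk' F x (t x)) =ᶠ[𝓝 p]
      e.toOpenPartialHomeomorph.symm ∘ fun x => (x, (e ⟨x, t x⟩).2) := by
    filter_upwards [e.open_baseSet.mem_nhds hp] with x hx
    have h1 : e ⟨x, t x⟩ = (x, (e ⟨x, t x⟩).2) := Prod.ext (e.coe_fst' hx) rfl
    have h2 := e.toOpenPartialHomeomorph.left_inv
      (e.mem_source.2 (show (⟨x, t x⟩ : TotalSpace F V).proj ∈ e.baseSet from hx))
    exact h2.symm.trans (congrArg e.toOpenPartialHomeomorph.symm h1)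
  have hG : HasMFDerivAt (I.prod 𝓘(ℝ, F)) (I.prod 𝓘(ℝ, F)) e.toOpenPartialHomeomorph.symm
      (p, (e ⟨p, t p⟩).2) _ := (mdiff_symm (I := I) e hp).hasMFDerivAt
  have h3 := ((hG.comp p hd).congr_of_eventuallyEq hc).mfderiv
  rw [h0]
  exact congrArg (fun L : E →L[ℝ] E × F => L v) h3

/-- The vertical lift `s^v` of a section: `s^v (q)` is the vertical vector at `q` given by
`s (π q)`. -/
noncomputable def vertSection : Cₛ^∞⟮I; F, V⟯ →+ VF (I.prod 𝓘(ℝ, F)) (TotalSpace F V) :=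
  AddMonoidHom.mk' (fun s => ⟨fun q => vert I q (s q.proj), fun q₀ => by
    have hq := mem_baseSet_trivializationAt F V q₀.proj
    refine (tri_smooth (0 : VF I M) hq (w := fun q => (trivializationAt F V q₀.proj
      ⟨q.proj, s q.proj⟩).2) ?_).congr_of_eventuallyEq ?_
    · have h : ContMDiffAt I 𝓘(ℝ, F) ∞ (fun x => (trivializationAt F V q₀.proj ⟨x, s x⟩).2)
          q₀.proj := (Trivialization.contMDiffAt_section_iff _ hq).1 s.contMDiff.contMDiffAt
      exact h.comp q₀ (contMDiff_proj V).contMDiffAt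
    · filter_upwards [(FiberBundle.continuous_proj F V).continuousAt.preimage_mem_nhds
        ((trivializationAt F V q₀.proj).open_baseSet.mem_nhds hq)] with q hq'
      exact congrArg (TotalSpace.mk' (E × F) q) (vert_eq hq' _)⟩)
    (fun s t => ContMDiffSection.ext fun q => vert_add q _ _)

/-- The Liouville (Euler) vector field `∇` on the total space. -/
noncomputable def euler : VF (I.prod 𝓘(ℝ, F)) (TotalSpace F V) :=
  ⟨fun q => vert I q q.2, fun q₀ => by
    have hq := mem_baseSet_trivializationAt F V q₀.proj
    refine (tri_smooth (0 : VF I M) hq (w := fun q => (trivializationAt F V q₀.proj q).2)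
      ?_).congr_of_eventuallyEq ?_
    · exact (((trivializationAt F V q₀.proj).contMDiffAt_iff
        ((trivializationAt F V q₀.proj).mem_source.2 hq)).1 contMDiffAt_id).2
    · filter_upwards [(FiberBundle.continuous_proj F V).continuousAt.preimage_mem_nhds
        ((trivializationAt F V q₀.proj).open_baseSet.mem_nhds hq)] with q hq'
      exact congrArg (TotalSpace.mk' (E × F) q) (vert_eq hq' _)⟩

/-- The tangent map at the base point of `q` of the section through `q`. -/
noncomputable def sectionTangent (q : TotalSpace F V) :
    TangentSpace I q.proj →L[ℝ] TangentSpace (I.prod 𝓘(ℝ, F)) q :=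
  mfderiv I (I.prod 𝓘(ℝ, F)) (fun x => TotalSpace.mk' F x (sectionThrough I q x)) q.proj

/-- The value at `q` of the complete lift of a section `s`: with a section `t` through `q` it is
`T t (a(s)) - ([s, t])^v`. It is the linear vector field over `a(s)` which satisfies
`s^c (ι_μ) = ι_{£_s μ}`, as `a(s)(μ t) - μ [s, t] = (£_s μ) t`, and does not depend on `t`. -/
noncomputable def completeVec (A : LieAlgebroid I F V) (s : Cₛ^∞⟮I; F, V⟯) (q : TotalSpace F V) :
    TangentSpace (I.prod 𝓘(ℝ, F)) q :=
  sectionTangent q (A.anchor s q.proj) - vert I q (A.bracket s (sectionThrough I q) q.proj)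

theorem frame_deriv {e : Trivialization F (π F V)} [MemTrivializationAtlas e]
    {ι : Type*} [Fintype ι] (b : Module.Basis ι ℝ F) {U : Set M} (hU : IsOpen U)
    (hUe : U ⊆ e.baseSet) {u : Cₛ^∞⟮I; F, V⟯} {g : ι → C^∞⟮I, M; 𝓘(ℝ, ℝ), ℝ⟯}
    (hg : ∀ x ∈ U, ∀ i, g i x = b.repr (e ⟨x, u x⟩).2 i) {x : M} (hx : x ∈ U)
    (v : TangentSpace I x) :
    mfderiv I 𝓘(ℝ, F) (fun x => (e ⟨x, u x⟩).2) x v = ∑ i, mvfderiv I (g i) x v • b i := by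
  have hs : ContMDiffAt I 𝓘(ℝ, F) ∞ (fun x => (e ⟨x, u x⟩).2) x :=
    (e.contMDiffAt_section_iff (hUe hx)).1 u.contMDiff.contMDiffAt
  have hd := (hs.mdifferentiableAt (by simp)).hasMFDerivAt
  refine (b.sum_repr _).symm.trans (Finset.sum_congr rfl fun i _ => ?_)
  congr 1
  have h1 := (LinearMap.toContinuousLinearMap (b.coord i)).hasMFDerivAt.comp x hd
  have h2 : (g i : M → ℝ) =ᶠ[𝓝 x] (LinearMap.toContinuousLinearMap (b.coord i)) ∘
      fun x => (e ⟨x, u x⟩).2 := by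
    filter_upwards [hU.mem_nhds hx] with y hy
    exact hg y hy i
  have h3 := (h1.congr_of_eventuallyEq h2).mfderiv
  exact (congrArg (fun L : E →L[ℝ] ℝ => L v) h3).symm

theorem completeVec_eq (A : LieAlgebroid I F V) (s : Cₛ^∞⟮I; F, V⟯)
    {e : Trivialization F (π F V)} [MemTrivializationAtlas e]
    {ι : Type*} [Fintype ι] (b : Module.Basis ι ℝ F) {U : Set M} (hU : IsOpen U) (hUe : U ⊆ e.baseSet)
    {t : ι → Cₛ^∞⟮I; F, V⟯} (ht : ∀ x ∈ U, ∀ i, (e ⟨x, t i x⟩).2 = b i)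
    {q : TotalSpace F V} (hg : ∃ g : ι → C^∞⟮I, M; 𝓘(ℝ, ℝ), ℝ⟯,
      ∀ x ∈ U, ∀ i, g i x = b.repr (e ⟨x, sectionThrough I q x⟩).2 i) (hx : q.proj ∈ U) :
    completeVec A s q = tri I e (e q) (A.anchor s q.proj)
      (-∑ i, b.repr (e q).2 i • (e ⟨q.proj, A.bracket s (t i) q.proj⟩).2) := by
  obtain ⟨g, hg⟩ := hg
  have h1 := section_deriv (sectionThrough I q) (hUe hx) (A.anchor s q.proj)
  have h2 := bracket_formula A s b hU hUe ht hg hx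
  rw [frame_deriv b hU hUe hg hx] at h1
  have h3 : (⟨q.proj, sectionThrough I q q.proj⟩ : TotalSpace F V) = q := by
    rw [sectionThrough_apply]
  rw [h3] at h1
  rw [sectionThrough_apply] at h2
  have h4 := vert_eq (I := I) (hUe hx) (A.bracket s (sectionThrough I q) q.proj)
  rw [h2] at h4
  have h5 (v : E) (w w' : F) : tri I e (e q) v w - tri I e (e q) 0 (w' + w)
      = tri I e (e q) v (-w') := by
    rw [sub_eq_iff_eq_add, ← tri_add]
    simp
  rw [Finset.sum_add_distrib] at h4
  refine Eq.trans ?_ (h5 _ (∑ i, mvfderiv I (g i) q.proj (A.anchor s q.proj) • b i) _)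
  exact congrArg₂ (fun x y : E × F => x - y) h1 h4

/-- The complete lift `s^c` of a section, a vector field on the total space. -/
noncomputable def completeSection (A : LieAlgebroid I F V) :
    Cₛ^∞⟮I; F, V⟯ →+ VF (I.prod 𝓘(ℝ, F)) (TotalSpace F V) :=
  AddMonoidHom.mk' (fun s => ⟨completeVec A s, fun q₀ => by
    obtain ⟨U, t, hU, hp, hUe, ht, hg⟩ := exists_frame (I := I) (V := V) (F := F) q₀.proj
    refine (tri_smooth (A.anchor s) (hUe hp) (w := fun q =>
      -∑ i, (Module.finBasis ℝ F).repr (trivializationAt F V q₀.proj q).2 i •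
        (trivializationAt F V q₀.proj ⟨q.proj, A.bracket s (t i) q.proj⟩).2)
      ?_).congr_of_eventuallyEq ?_
    · refine ContMDiffAt.neg (ContMDiffAt.sum fun i _ => (contMDiffAt_coord _ (hUe hp) i).smul ?_)
      have h : ContMDiffAt I 𝓘(ℝ, F) ∞ (fun x => (trivializationAt F V q₀.proj
          ⟨x, A.bracket s (t i) x⟩).2) q₀.proj :=
        (Trivialization.contMDiffAt_section_iff _ (hUe hp)).1
          (A.bracket s (t i)).contMDiff.contMDiffAt
      exact h.comp q₀ (contMDiff_proj V).contMDiffAt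
    · filter_upwards [(FiberBundle.continuous_proj F V).continuousAt.preimage_mem_nhds
        (hU.mem_nhds hp)] with q hq
      exact congrArg (TotalSpace.mk' (E × F) q)
        (completeVec_eq A s _ hU hUe ht (hg (sectionThrough I q)) hq)⟩)
    (fun s s' => ContMDiffSection.ext fun q => by
      have h : vert I q (A.bracket (s + s') (sectionThrough I q) q.proj)
          = vert I q (A.bracket s (sectionThrough I q) q.proj)
            + vert I q (A.bracket s' (sectionThrough I q) q.proj) := by
        rw [← vert_add, map_add]; rfl
      have h' : A.anchor (s + s') q.proj = A.anchor s q.proj + A.anchor s' q.proj := by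
        rw [map_add]; rfl
      change completeVec A (s + s') q = completeVec A s q + completeVec A s' q
      unfold completeVec
      rw [h, h', map_add]
      exact add_sub_add_comm (α := E × F) _ _ _ _)

theorem completeSection_smul (A : LieAlgebroid I F V) (f : C^∞⟮I, M; 𝓘(ℝ, ℝ), ℝ⟯)
    (s : Cₛ^∞⟮I; F, V⟯) : completeSection A (f • s) = pullback F V f • completeSection A s
      + linFun (A.toAnchoredBracket.d₀ f) • vertSection s :=
  ContMDiffSection.ext fun q => by
    set t := sectionThrough I q
    have h : vert I q (A.bracket (f • s) t q.proj) = f q.proj • vert I q (A.bracket s t q.proj)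
        - (A.anchor t).act f q.proj • vert I q (s q.proj) := by
      have h1 : A.bracket (f • s) t = f • A.bracket s t + (-(A.anchor t).act f) • s := by
        rw [neg_smul, ← sub_eq_add_neg]
        exact A.toAnchoredBracket.bracket_smul_left f s t
      rw [h1, sub_eq_add_neg, ← neg_smul, ← vert_smul, ← vert_smul, ← vert_add]
      rfl
    have h' : A.anchor (f • s) q.proj = f q.proj • A.anchor s q.proj := by
      rw [map_smul]; rfl
    change completeVec A (f • s) q = f q.proj • completeVec A s q
      + (A.anchor t).act f q.proj • vert I q (s q.proj)
    unfold completeVec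
    rw [h, h', map_smul]
    have h4 (x y z : E × F) (c d : ℝ) : c • x - (c • y - d • z) = c • (x - y) + d • z := by
      rw [smul_sub]; abel
    exact h4 _ _ _ _ _

theorem vertSection_smul (f : C^∞⟮I, M; 𝓘(ℝ, ℝ), ℝ⟯)
    (s : Cₛ^∞⟮I; F, V⟯) : vertSection (f • s) = pullback F V f • vertSection s :=
  ContMDiffSection.ext fun q => vert_smul q (f q.proj) (s q.proj)

theorem linFun_add (μ ν : Module.Dual C^∞⟮I, M; 𝓘(ℝ, ℝ), ℝ⟯ Cₛ^∞⟮I; F, V⟯) :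
    linFun (μ + ν) = linFun μ + linFun ν := rfl

theorem linFun_smul (f : C^∞⟮I, M; 𝓘(ℝ, ℝ), ℝ⟯)
    (μ : Module.Dual C^∞⟮I, M; 𝓘(ℝ, ℝ), ℝ⟯ Cₛ^∞⟮I; F, V⟯) :
    linFun (f • μ) = pullback F V f * linFun μ := rfl

/-- The vertical lift of multisections: the homomorphism of Grassmann algebras with `f^v = f ∘ π`
on functions which is the vertical lift on sections. -/
noncomputable def verticalLift :
    MultiSection I F V →+* MultiVector (I.prod 𝓘(ℝ, F)) (TotalSpace F V) :=
  liftSemi ((algebraMap _ _).comp (pullback F V))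
    ((ExteriorAlgebra.ι _).toAddMonoidHom.comp vertSection)
    (fun f s => by simp [vertSection_smul, Algebra.smul_def])
    (fun f s => Algebra.commutes _ _)
    (fun s => ExteriorAlgebra.ι_sq_zero _)

@[simp] theorem verticalLift_algebraMap (f : C^∞⟮I, M; 𝓘(ℝ, ℝ), ℝ⟯) :
    verticalLift (algebraMap _ (MultiSection I F V) f) = algebraMap _ _ (pullback F V f) :=
  liftSemi_algebraMap _ _ _ _ _ f

@[simp] theorem verticalLift_ι (s : Cₛ^∞⟮I; F, V⟯) :
    verticalLift (ExteriorAlgebra.ι C^∞⟮I, M; 𝓘(ℝ, ℝ), ℝ⟯ s)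
      = ExteriorAlgebra.ι _ (vertSection s) :=
  liftSemi_ι _ _ _ _ _ s

/-- The differential of functions, as linear functions on the total space: `f ↦ ι_{df}`. -/
noncomputable def linDiff (A : LieAlgebroid I F V) : C^∞⟮I, M; 𝓘(ℝ, ℝ), ℝ⟯ →+
    C^∞⟮I.prod 𝓘(ℝ, F), TotalSpace F V; 𝓘(ℝ, ℝ), ℝ⟯ :=
  AddMonoidHom.mk' (fun f => linFun (A.toAnchoredBracket.d₀ f))
    (fun f g => by rw [AnchoredBracket.d₀_add, linFun_add])

theorem completeLift_derData (A : LieAlgebroid I F V) :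
    DerData (verticalLift : MultiSection I F V →+* _) verticalLift
      ((algebraMap _ (MultiVector (I.prod 𝓘(ℝ, F)) (TotalSpace F V))).toAddMonoidHom.comp
        (linDiff A))
      ((ExteriorAlgebra.ι _).toAddMonoidHom.comp (completeSection A)) :=
  lift_derData verticalLift_algebraMap verticalLift_ι
    (fun f g => by
      simp only [linDiff, AddMonoidHom.mk'_apply, AnchoredBracket.d₀_mul, linFun_add, linFun_smul]
      rw [mul_comm (pullback F V g)])
    (completeSection_smul A)

/-- The complete lift of multisections: `f^c = ι_{df}` on functions, the complete lift on sections,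
and `(X ∧ Y)^c = X^c ∧ Y^v + X^v ∧ Y^c`. -/
noncomputable def completeLift (A : LieAlgebroid I F V) :
    MultiSection I F V →+ MultiVector (I.prod 𝓘(ℝ, F)) (TotalSpace F V) :=
  derExt (completeLift_derData A)

/-- The Poisson lift `X^c_Φ = X^c - x ι_Φ X^v + ∇ ∧ (i_Φ X)^v` for `X` of exterior degree `x + 1`. -/
noncomputable def poissonLift (J : JacobiAlgebroid I F V) (X : MultiSection I F V) :
    MultiVector (I.prod 𝓘(ℝ, F)) (TotalSpace F V) :=
  completeLift J.toLieAlgebroid X - linFun J.Φ • verticalLift (degOp X)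
    + ExteriorAlgebra.ι _ euler * verticalLift (contr J.Φ X)

end Frames

end Algebroid

namespace Grassmann

/-! ### Signs, contractions and the degree derivation in a Grassmann algebra -/

section Degree

variable {R N : Type*} [CommRing R] [AddCommGroup N] [Module R N]

/-! Write `m = ι_Φ`, let `v` be the vertical lift, and let `k` be the exterior degree, so that `x =
k - 1`. The Poisson lift is then `Q + m v` with `Q X = X^c - k m X^v + ∇ ∧ (i_Φ X)^v`. The shift
from `x` to `k` matters because `k` is a derivation, whereas `x` is not. Hence `Q` is a derivation
along `v` (`liftDer_mul`), where the sign in the antiderivation rule of `i_Φ` is absorbed by moving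
the odd element `∇` to its place. Statement (c) is this Leibniz rule with the multiples of `m`
collected, and (a) and (b) are the values of `Q + m v` on generators.

For (d), fix `Y` of one parity. The Schouten-Jacobi bracket is not a derivation in `X`, but `B(X) =
[X, Y]^Φ + X ∧ i_Φ Y` is one, up to the usual sign (`derBracket_mul`). Induction on `X` from
functions and sections gives `[v X, Y^c_Φ] = v (B X)` and `[Q X, Y^c_Φ] = Q (B X) - Q X ∧ v (i_Φ Y)`
(`schouten_v`, `schouten_Q`). Together with `[m, Y^c_Φ] = -(i_Φ Y)^c_Φ`, these add up to the lift of
`B X - X ∧ i_Φ Y = [X, Y]^Φ`. The argument uses only the values of brackets and anchors on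
generators, which are collected in `LiftData`.

Those values are a computation with vector fields on the total space. A vector field there is
determined by its action on pull-backs and on fibrewise linear functions (`VF.eq_of_act`). The
vertical lift `s^v` kills pull-backs and sends `ι_μ` to `π^* (μ s)`. The Poisson lift of `s` is `s^c
+ π^*(Φ s) ∇`, and it acts on `ι_μ` as `£^Φ_s`. The brackets of these fields therefore follow from
`£^Φ_[s,t] = [£^Φ_s, £^Φ_t]`, which combines the Jacobi identity, the fact that the anchor preserves
brackets, and `dΦ = 0` (`jacobiLie_bracket`). -/

theorem contr_mul (Φ : Module.Dual R N) (X Y : ExteriorAlgebra R N) :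
    contr Φ (X * Y) = contr Φ X * Y + parity X * contr Φ Y := by
  induction X using left_induction with
  | hr r => simp [contr, parity, ← Algebra.smul_def]
  | ha X X' hX hX' => simp only [add_mul, map_add, hX, hX']; abel
  | hm X s hX =>
    rw [mul_assoc, contr_ι_mul, contr_ι_mul, hX, map_mul, parity_ι]
    simp only [mul_add, sub_mul, smul_mul_assoc, neg_mul, mul_assoc]
    abel

@[simp] theorem contr_algebraMap (Φ : Module.Dual R N) (r : R) :
    contr Φ (algebraMap R (ExteriorAlgebra R N) r) = 0 := by simp [contr]

@[simp] theorem contr_ι (Φ : Module.Dual R N) (s : N) :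
    contr Φ (ExteriorAlgebra.ι R s) = algebraMap R _ (Φ s) := by
  have := contr_ι_mul Φ s 1
  simpa [contr, Algebra.smul_def] using this

theorem parity_parity (X : ExteriorAlgebra R N) : parity (parity X) = X := by simp [parity]

/-- Graded commutativity: an odd element passes a factor of degree `k` at the cost of `(-1) ^ k`. It
suffices to check this on generators, as both sides are compatible with products in `X`. -/
theorem parity_mul_eq_mul_of_odd (X : ExteriorAlgebra R N) {Z : ExteriorAlgebra R N}
    (hZ : parity Z = -Z) : parity X * Z = Z * X := by
  induction X using ExteriorAlgebra.induction with
  | algebraMap r => simp [parity, Algebra.commutes]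
  | ι s => rw [parity_ι, neg_mul, ι_mul_eq, hZ, neg_mul, neg_neg]
  | mul X X' hX hX' => rw [map_mul, mul_assoc, hX', ← mul_assoc, hX, mul_assoc]
  | add X X' hX hX' => rw [map_add, add_mul, hX, hX', mul_add]

theorem mul_eq_mul_of_even (X : ExteriorAlgebra R N) {Z : ExteriorAlgebra R N}
    (hZ : parity Z = Z) : X * Z = Z * X := by
  induction X using ExteriorAlgebra.induction with
  | algebraMap r => simp [Algebra.commutes]
  | ι s => rw [ι_mul_eq, hZ]
  | mul X X' hX hX' => rw [mul_assoc, hX', ← mul_assoc, hX, mul_assoc]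
  | add X X' hX hX' => rw [add_mul, hX, hX', mul_add]

theorem parity_map {R' N' : Type*} [CommRing R'] [AddCommGroup N'] [Module R' N']
    {v : ExteriorAlgebra R N →+* ExteriorAlgebra R' N'} {p : R → R'} {w : N → N'}
    (hp : ∀ f, v (algebraMap R _ f) = algebraMap R' _ (p f))
    (hw : ∀ s, v (ExteriorAlgebra.ι R s) = ExteriorAlgebra.ι R' (w s))
    (Y : ExteriorAlgebra R N) : parity (v Y) = v (parity Y) := by
  induction Y using ExteriorAlgebra.induction with
  | algebraMap r => simp [parity, hp]
  | ι s => simp [hw]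
  | mul X Y hX hY => simp only [map_mul, hX, hY]
  | add X Y hX hY => simp only [map_add, hX, hY]

/-- The exterior degree as a derivation of the Grassmann algebra: `X ↦ k X` on elements of
degree `k`. -/
noncomputable def degDer : ExteriorAlgebra R N →+ ExteriorAlgebra R N :=
  degOp + AddMonoidHom.id _

theorem degOp_eq (X : ExteriorAlgebra R N) : degOp X = degDer X - X := by simp [degDer]

theorem degDer_of_mem {k : ℕ} {X : ExteriorAlgebra R N} (hX : X ∈ ⋀[R]^k N) :
    degDer X = (k : ℤ) • X := by
  simp [degDer, degOp_of_mem hX, sub_smul]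

@[simp] theorem degDer_algebraMap (r : R) :
    degDer (algebraMap R (ExteriorAlgebra R N) r) = 0 := by
  have h : algebraMap R (ExteriorAlgebra R N) r ∈ ⋀[R]^0 N := by
    simp [Submodule.mem_one]
  simp [degDer_of_mem h]

@[simp] theorem degDer_ι (s : N) :
    degDer (ExteriorAlgebra.ι R s) = ExteriorAlgebra.ι R s := by
  have h : ExteriorAlgebra.ι R s ∈ ⋀[R]^1 N := by simp
  simp [degDer_of_mem h]

/-- Degrees add under products, so the rule is immediate for homogeneous factors and extends by
additivity. -/
theorem degDer_mul (X Y : ExteriorAlgebra R N) :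
    degDer (X * Y) = X * degDer Y + degDer X * Y := by
  induction X using DirectSum.Decomposition.inductionOn (fun k : ℕ => ⋀[R]^k N) with
  | zero => simp
  | add X X' hX hX' => simp only [add_mul, map_add, hX, hX']; abel
  | homogeneous X =>
    rename_i k
    induction Y using DirectSum.Decomposition.inductionOn (fun k : ℕ => ⋀[R]^k N) with
    | zero => simp
    | add Y Y' hY hY' => simp only [mul_add, map_add, hY, hY']; abel
    | homogeneous Y =>
      rename_i l
      have h : (X : ExteriorAlgebra R N) * Y ∈ ⋀[R]^(k + l) N := SetLike.mul_mem_graded X.2 Y.2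
      rw [degDer_of_mem h, degDer_of_mem X.2, degDer_of_mem Y.2]
      simp only [Nat.cast_add, add_smul, mul_smul_comm, smul_mul_assoc, add_comm]

theorem parity_degDer (X : ExteriorAlgebra R N) : parity (degDer X) = degDer (parity X) := by
  induction X using ExteriorAlgebra.induction with
  | algebraMap r => simp [parity]
  | ι s => simp
  | mul X Y hX hY => simp only [map_mul, degDer_mul, map_add, hX, hY]
  | add X Y hX hY => simp only [map_add, hX, hY]

end Degree

/-! ### Additivity of the Schouten bracket and a bracket computation -/

namespace AnchoredBracket

section

variable {R N : Type*} [CommRing R] [Algebra ℝ R] [AddCommGroup N] [Module R N]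
  (P : AnchoredBracket R N)

theorem schouten_add_left (X X' Y : ExteriorAlgebra R N) :
    P.schouten (X + X') Y = P.schouten X Y + P.schouten X' Y := by
  simp only [schouten, map_add]; abel

theorem jacobiLie_apply (Φ μ : Module.Dual R N) (s t : N) : P.jacobiLie Φ s μ t
    = P.anchor s (μ t) + Φ s * μ t - μ (P.bracket s t) := by
  change P.rep Φ s (μ t) - P.rep Φ t (μ s) - μ (P.bracket s t)
    + (P.anchor t (μ s) + μ s * Φ t) = _
  simp only [rep]
  ring

/-- Isolates the calculation of `[s^c_Φ - m s^v, t^c_Φ - m t^v]`. Here `X`, `Y` stand for the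
Poisson lifts of `s`, `t`, then `W`, `Z` for their vertical lifts, and `A` for the vertical lift of
`[s, t]`. The functions `b`, `c` are the pull-backs of `Φ t`, `Φ s`, and `b'`, `c'` are the linear
functions of their differentials. -/
theorem bracket_sub_smul {X Y W Z U A : N} {m b b' c c' : R} (hXY : P.bracket X Y = U)
    (hWY : P.bracket W Y = A + b • W) (hZX : P.bracket Z X = -A + c • Z)
    (hWZ : P.bracket W Z = 0) (hW : P.anchor W m = c) (hZ : P.anchor Z m = b)
    (hX : P.anchor X m = c' + c * m) (hY : P.anchor Y m = b' + b * m) :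
    P.bracket (X - m • W) (Y - m • Z)
      = U - m • A + b' • W - c' • Z - m • (A + b • W - c • Z) := by
  have hXZ : P.bracket X Z = A - c • Z := by
    rw [P.bracket_skew, hZX, neg_add, neg_neg, sub_eq_add_neg]
  simp only [map_sub, AddMonoidHom.sub_apply, P.leibniz, P.bracket_smul_left, hXY, hWY, hXZ, hWZ,
    hW, hZ, hX, hY]
  simp only [map_smul, Derivation.smul_apply, smul_eq_mul, hW]
  module

/-- `schouten` is the sum of two derivations, built from the odd and from the even part of its right
argument. For an odd right argument the second one vanishes, so the first is itself a Schouten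
bracket. -/
theorem schouten_of_odd (X : ExteriorAlgebra R N) {Y Z : ExteriorAlgebra R N} (hY : parity Y = -Y)
    (hZ : oddPart Z = Y) : derExt (P.odd_derData (oddPart Z) (parity_oddPart Z)) X
      = P.schouten X Y := by
  have h0 : evenPart Y = 0 := by simp [evenPart, hY]
  have h (Z) : derExt (P.even_derData (evenPart Y) (parity_evenPart Y)) Z = 0 :=
    derExt_eq_zero _ (fun r => by simp [scalarBracket, h0])
      (fun s => by simp [sectionBracket, h0]) Z
  have h1 : oddPart Y = Y := by simpa [h0] using oddPart_add_evenPart Y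
  simp only [schouten, h, add_zero]
  have h2 := hZ.trans h1.symm
  -- The derivation carries a proof about its right argument, so the two equal odd parts are
  -- exchanged by congruence.
  congr! 2 <;> rw [h2]

theorem schouten_of_even (X : ExteriorAlgebra R N) {Y Z : ExteriorAlgebra R N} (hY : parity Y = Y)
    (hZ : evenPart Z = Y) : derExt (P.even_derData (evenPart Z) (parity_evenPart Z)) X
      = P.schouten X Y := by
  have h0 : oddPart Y = 0 := by simp [oddPart, hY]
  have h (Z) : derExt (P.odd_derData (oddPart Y) (parity_oddPart Y)) Z = 0 :=
    derExt_eq_zero _ (fun r => by simp [scalarBracket, h0])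
      (fun s => by simp [sectionBracket, h0]) Z
  have h1 : evenPart Y = Y := by simpa [h0] using oddPart_add_evenPart Y
  simp only [schouten, h, zero_add]
  have h2 := hZ.trans h1.symm
  congr! 2 <;> rw [h2]

/-- The definition treats the two parities of the right argument separately, so the bracket splits
along the parity decomposition. This is all the right additivity that the reduction to one parity
needs. -/
theorem schouten_add_right_of_parity (X : ExteriorAlgebra R N) {Y Y' : ExteriorAlgebra R N}
    (hY : parity Y = -Y) (hY' : parity Y' = Y') :
    P.schouten X (Y + Y') = P.schouten X Y + P.schouten X Y' := by
  have h2 : algebraMap ℝ R 2⁻¹ * 2 = 1 := by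
    rw [← map_ofNat (algebraMap ℝ R) 2, ← map_mul]; norm_num
  have h (Z : ExteriorAlgebra R N) : algebraMap ℝ R 2⁻¹ • (Z + Z) = Z := by
    rw [← two_smul R Z, smul_smul, h2, one_smul]
  rw [← P.schouten_of_odd X hY (Z := Y + Y'), ← P.schouten_of_even X hY' (Z := Y + Y')]
  · rfl
  · rw [evenPart, map_add, hY, hY', add_add_add_comm, add_neg_cancel, zero_add, h]
  · rw [oddPart, map_add, hY, hY', add_sub_add_comm, sub_self, sub_neg_eq_add, add_zero, h]

end
end AnchoredBracket

/-! ### Both parities of the right argument at once -/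

section Sign

variable {R N : Type*} [CommRing R] [AddCommGroup N] [Module R N]

/-- The automorphism `X' ↦ (-1) ^ (x' y) X'` for `X'` of exterior degree `x'`, where `y + 1` is an
exterior degree which is even if `ε` is true and odd otherwise. -/
noncomputable def signAut (ε : Bool) : ExteriorAlgebra R N →ₐ[R] ExteriorAlgebra R N :=
  cond ε parity (AlgHom.id R _)

/-- The element `Y` is even if `ε` is true and odd otherwise. -/
def HasParity (ε : Bool) (Y : ExteriorAlgebra R N) : Prop := parity Y = cond ε Y (-Y)

variable {ε : Bool} {Y : ExteriorAlgebra R N}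

/-- Contraction changes parity: for odd `Y` the factor `i_Φ Y` is even and commutes with everything,
and for even `Y` it is odd. -/
theorem HasParity.mul_contr (hY : HasParity ε Y) (Φ : Module.Dual R N)
    (X : ExteriorAlgebra R N) : X * contr Φ Y = contr Φ Y * signAut ε X := by
  cases ε
  · exact mul_eq_mul_of_even X (by rw [parity_contr, show parity Y = -Y from hY]; simp)
  · have h := parity_mul_eq_mul_of_odd (parity X) (Z := contr Φ Y)
      (by rw [parity_contr, show parity Y = Y from hY])
    rwa [parity_parity] at h

theorem HasParity.parity_mul (hY : HasParity ε Y) (X : ExteriorAlgebra R N) :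
    parity X * Y = Y * signAut ε X := by
  cases ε
  · exact parity_mul_eq_mul_of_odd X hY
  · exact mul_eq_mul_of_even _ hY

theorem HasParity.degOp (hY : HasParity ε Y) : HasParity ε (degOp Y) := by
  unfold HasParity
  rw [degOp_eq, map_sub, parity_degDer, show parity Y = _ from hY]
  cases ε
  · simp; abel
  · simp

theorem AnchoredBracket.schouten_mul [Algebra ℝ R] (P : AnchoredBracket R N) (hY : HasParity ε Y)
    (X X' : ExteriorAlgebra R N) :
    P.schouten (X * X') Y = X * P.schouten X' Y + P.schouten X Y * signAut ε X' := by
  cases ε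
  · exact P.schouten_mul_of_odd X X' hY
  · exact P.schouten_mul_of_even X X' hY

end Sign

/-! ### The derivation along the vertical lift inside the Poisson lift -/

section Derivation

variable {R N R' N' : Type*} [CommRing R] [AddCommGroup N] [Module R N] [CommRing R']
  [AddCommGroup N'] [Module R' N'] (D : ExteriorAlgebra R N →+ ExteriorAlgebra R' N')
  (v : ExteriorAlgebra R N →+* ExteriorAlgebra R' N') (m : R') (e : N') (Φ : Module.Dual R N)

/-- The additive map `X ↦ D X - k m v(X) + e ∧ v(i_Φ X)` for `X` of exterior degree `k`. -/
noncomputable def liftDer : ExteriorAlgebra R N →+ ExteriorAlgebra R' N' :=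
  AddMonoidHom.mk' (fun X => D X - m • v (degDer X) + ExteriorAlgebra.ι _ e * v (contr Φ X))
    (fun X Y => by simp only [map_add, smul_add, mul_add]; abel)

theorem liftDer_apply (X : ExteriorAlgebra R N) : liftDer D v m e Φ X
    = D X - m • v (degDer X) + ExteriorAlgebra.ι _ e * v (contr Φ X) := rfl

theorem liftDer_add_smul (X : ExteriorAlgebra R N) :
    D X - m • v (degOp X) + ExteriorAlgebra.ι _ e * v (contr Φ X)
      = liftDer D v m e Φ X + m • v X := by
  rw [liftDer_apply, degOp_eq, map_sub, smul_sub]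
  abel

variable {D v}

/-- Each of the three summands is a derivation along `v`. For `e ∧ v (i_Φ X)`, the antiderivation
rule of `i_Φ` yields `parity X`, and moving the odd element `e` past `v (parity X)` cancels that
sign. -/
theorem liftDer_mul (hD : ∀ X Y, D (X * Y) = v X * D Y + D X * v Y)
    (hv : ∀ X, parity (v X) = v (parity X)) (X Y : ExteriorAlgebra R N) :
    liftDer D v m e Φ (X * Y)
      = liftDer D v m e Φ X * v Y + v X * liftDer D v m e Φ Y := by
  have h := ι_mul_eq e (v (parity X))
  rw [hv, parity_parity] at h
  simp only [liftDer_apply, hD, degDer_mul, contr_mul, map_add, map_mul,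
    smul_add, add_mul, sub_mul, mul_add, mul_sub, smul_mul_assoc, mul_smul_comm, ← mul_assoc, h]
  abel

theorem liftDer_algebraMap {f : R} {g : R'} (hD : D (algebraMap R _ f) = algebraMap R' _ g) :
    liftDer D v m e Φ (algebraMap R _ f) = algebraMap R' _ g := by
  simp [liftDer_apply, hD]

theorem liftDer_ι {s : N} {c w : N'} {p : R'}
    (hD : D (ExteriorAlgebra.ι R s) = ExteriorAlgebra.ι R' c)
    (hv : v (ExteriorAlgebra.ι R s) = ExteriorAlgebra.ι R' w)
    (hp : v (algebraMap R _ (Φ s)) = algebraMap R' _ p) :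
    liftDer D v m e Φ (ExteriorAlgebra.ι R s) = ExteriorAlgebra.ι R' (c + p • e - m • w) := by
  simp only [liftDer_apply, hD, degDer_ι, contr_ι, hv, hp, ← Algebra.commutes,
    ← Algebra.smul_def, map_add, map_sub, map_smul]
  abel

end Derivation

/-! ### Compatibility of the lift with brackets, reduced to generators -/

section Lift

variable {R N R' N' : Type*} [CommRing R] [Algebra ℝ R] [AddCommGroup N] [Module R N]
  [CommRing R'] [Algebra ℝ R'] [AddCommGroup N'] [Module R' N']

/-- Algebraic data on functions and sections for a vertical lift `v` and a derivation `Q` along `v`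
of Grassmann algebras with `Q + m v` compatible with the Schouten-Jacobi bracket. -/
structure LiftData (P : AnchoredBracket R N) (P' : AnchoredBracket R' N') (Φ : Module.Dual R N)
    (v : ExteriorAlgebra R N →+* ExteriorAlgebra R' N')
    (Q : ExteriorAlgebra R N →+ ExteriorAlgebra R' N')
    (p : R →+* R') (δ : R →+ R') (m : R') (w q : N →+ N') : Prop where
  v_scalar : ∀ f, v (algebraMap R _ f) = algebraMap R' _ (p f)
  v_ι : ∀ s, v (ExteriorAlgebra.ι R s) = ExteriorAlgebra.ι R' (w s)
  Q_scalar : ∀ f, Q (algebraMap R _ f) = algebraMap R' _ (δ f)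
  Q_ι : ∀ s, Q (ExteriorAlgebra.ι R s) = ExteriorAlgebra.ι R' (q s)
  Q_mul : ∀ X Y, Q (X * Y) = Q X * v Y + v X * Q Y
  w_p : ∀ s f, P'.anchor (w s) (p f) = 0
  q_p : ∀ s f, P'.anchor (q s) (p f) = p (P.anchor s f)
  w_m : ∀ s, P'.anchor (w s) m = p (Φ s)
  w_δ : ∀ s f, P'.anchor (w s) (δ f) = p (P.anchor s f)
  q_m : ∀ s, P'.anchor (q s) m = δ (Φ s)
  q_δ : ∀ s f, P'.anchor (q s) (δ f)
    = δ (P.anchor s f) + p (Φ s) * δ f - m * p (P.anchor s f)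
  w_w : ∀ s t, P'.bracket (w s) (w t) = 0
  w_q : ∀ s t, P'.bracket (w s) (q t)
    = w (P.bracket s t) + p (Φ t) • w s - p (Φ s) • w t
  q_q : ∀ s t, P'.bracket (q s) (q t) = q (P.bracket s t) + δ (Φ t) • w s - δ (Φ s) • w t
    - m • (w (P.bracket s t) + p (Φ t) • w s - p (Φ s) • w t)

namespace LiftData

open AnchoredBracket

variable {P : AnchoredBracket R N} {P' : AnchoredBracket R' N'} {Φ : Module.Dual R N}
    {v : ExteriorAlgebra R N →+* ExteriorAlgebra R' N'}
    {Q : ExteriorAlgebra R N →+ ExteriorAlgebra R' N'}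
    {p : R →+* R'} {δ : R →+ R'} {m : R'} {w q : N →+ N'}
    (h : LiftData P P' Φ v Q p δ m w q)

theorem parity_v (h : LiftData P P' Φ v Q p δ m w q) (Y : ExteriorAlgebra R N) :
    parity (v Y) = v (parity Y) := parity_map h.v_scalar h.v_ι Y

theorem parity_Q (h : LiftData P P' Φ v Q p δ m w q) (Y : ExteriorAlgebra R N) :
    parity (Q Y) = Q (parity Y) := by
  induction Y using ExteriorAlgebra.induction with
  | algebraMap r => simp [parity, h.Q_scalar]
  | ι s => simp [h.Q_ι]
  | mul X Y hX hY => simp only [map_mul, h.Q_mul, map_add, h.parity_v, hX, hY]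
  | add X Y hX hY => simp only [map_add, hX, hY]

theorem signAut_v (h : LiftData P P' Φ v Q p δ m w q) (ε : Bool) (Y : ExteriorAlgebra R N) :
    signAut ε (v Y) = v (signAut ε Y) := by
  cases ε
  · rfl
  · exact h.parity_v Y

theorem signAut_Q (h : LiftData P P' Φ v Q p δ m w q) (ε : Bool) (Y : ExteriorAlgebra R N) :
    signAut ε (Q Y) = Q (signAut ε Y) := by
  cases ε
  · rfl
  · exact h.parity_Q Y

theorem v_smul (h : LiftData P P' Φ v Q p δ m w q) (f : R) (Y : ExteriorAlgebra R N) :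
    v (f • Y) = p f • v Y := by
  rw [Algebra.smul_def, map_mul, h.v_scalar, Algebra.smul_def]

theorem Q_smul (h : LiftData P P' Φ v Q p δ m w q) (f : R) (Y : ExteriorAlgebra R N) :
    Q (f • Y) = p f • Q Y + δ f • v Y := by
  rw [Algebra.smul_def, h.Q_mul, h.v_scalar, h.Q_scalar, Algebra.smul_def, Algebra.smul_def,
    add_comm]

theorem contr_p_v (h : LiftData P P' Φ v Q p δ m w q) (f : R) (Y : ExteriorAlgebra R N) :
    contr (P'.d₀ (p f)) (v Y) = 0 := by
  induction Y using ExteriorAlgebra.induction with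
  | algebraMap r => simp [h.v_scalar]
  | ι s => simp [h.v_ι, d₀, h.w_p]
  | mul X Y hX hY => simp only [map_mul, contr_mul, hX, hY, zero_mul, mul_zero, add_zero]
  | add X Y hX hY => simp only [map_add, hX, hY, add_zero]

theorem contr_p_Q (h : LiftData P P' Φ v Q p δ m w q) (f : R) (Y : ExteriorAlgebra R N) :
    contr (P'.d₀ (p f)) (Q Y) = v (contr (P.d₀ f) Y) := by
  induction Y using ExteriorAlgebra.induction with
  | algebraMap r => simp [h.Q_scalar]
  | ι s => simp [h.Q_ι, d₀, h.q_p, h.v_scalar]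
  | mul X Y hX hY =>
    simp only [h.Q_mul, map_add, map_mul, contr_mul, hX, hY, h.contr_p_v, h.parity_v]
    simp
  | add X Y hX hY => simp only [map_add, hX, hY]

/-- The function `k` plays the role of the linear function of `μ`. The cases needed are `k = δ f`,
`μ = df` and `k = m`, `μ = Φ`. -/
theorem contr_v (h : LiftData P P' Φ v Q p δ m w q) {k : R'} {μ : Module.Dual R N}
    (hw : ∀ s, P'.anchor (w s) k = p (μ s)) (Y : ExteriorAlgebra R N) :
    contr (P'.d₀ k) (v Y) = v (contr μ Y) := by
  induction Y using ExteriorAlgebra.induction with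
  | algebraMap r => simp [h.v_scalar]
  | ι s => simp [h.v_ι, d₀, h.v_scalar, hw]
  | mul X Y hX hY => simp only [map_mul, map_add, contr_mul, hX, hY, h.parity_v]
  | add X Y hX hY => simp only [map_add, hX, hY]

/-- Proved by induction over products: contraction is an antiderivation, and `v` and `Q` preserve
parity. For `k = m`, `μ = Φ` the last two terms cancel, so that `i_{dm} Q = Q i_Φ`. -/
theorem contr_Q (h : LiftData P P' Φ v Q p δ m w q) {k : R'} {μ : Module.Dual R N}
    (hw : ∀ s, P'.anchor (w s) k = p (μ s))
    (hq : ∀ s, P'.anchor (q s) k = δ (μ s) + p (Φ s) * k - m * p (μ s))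
    (Y : ExteriorAlgebra R N) :
    contr (P'.d₀ k) (Q Y) = Q (contr μ Y) + k • v (contr Φ Y) - m • v (contr μ Y) := by
  induction Y using ExteriorAlgebra.induction with
  | algebraMap r => simp [h.Q_scalar]
  | ι s =>
    simp [h.Q_ι, d₀, h.v_scalar, h.Q_scalar, hq, Algebra.smul_def]
    rw [Algebra.commutes k]
  | mul X Y hX hY =>
    simp only [h.Q_mul, map_add, map_mul, contr_mul, hX, hY, h.parity_v, h.parity_Q, h.contr_v hw]
    simp only [smul_add, add_mul, sub_mul, mul_add, mul_sub, smul_mul_assoc, mul_smul_comm]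
    abel
  | add X Y hX hY => simp only [map_add, hX, hY, smul_add]; abel

/-- The derivation `X ↦ [s, X]^Φ + s ∧ i_Φ X - Φ s X` of the Grassmann algebra, which extends
`t ↦ [s, t] + Φ t • s - Φ s • t`. -/
noncomputable def twistedLie (P : AnchoredBracket R N) (Φ : Module.Dual R N) (s : N)
    (Y : ExteriorAlgebra R N) : ExteriorAlgebra R N :=
  P.lieDer s Y + ExteriorAlgebra.ι R s * contr Φ Y - Φ s • degDer Y

theorem twistedLie_algebraMap (s : N) (f : R) :
    twistedLie P Φ s (algebraMap R _ f) = algebraMap R _ (P.anchor s f) := by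
  simp [twistedLie]

theorem twistedLie_ι (s t : N) : twistedLie P Φ s (ExteriorAlgebra.ι R t)
    = ExteriorAlgebra.ι R (P.bracket s t + Φ t • s - Φ s • t) := by
  simp [twistedLie, Algebra.smul_def, Algebra.commutes]

theorem twistedLie_add (s : N) (X Y : ExteriorAlgebra R N) :
    twistedLie P Φ s (X + Y) = twistedLie P Φ s X + twistedLie P Φ s Y := by
  simp only [twistedLie, map_add, mul_add, smul_add]; abel

theorem twistedLie_mul (s : N) (X Y : ExteriorAlgebra R N) :
    twistedLie P Φ s (X * Y) = X * twistedLie P Φ s Y + twistedLie P Φ s X * Y := by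
  have h := ι_mul_eq s (parity X)
  rw [parity_parity] at h
  simp only [twistedLie, lieDer_mul, contr_mul, degDer_mul, mul_add, add_mul, mul_sub, sub_mul,
    smul_add, mul_smul_comm, smul_mul_assoc, ← mul_assoc, h]
  abel

theorem lieDer_w_v (h : LiftData P P' Φ v Q p δ m w q) (s : N) (Y : ExteriorAlgebra R N) :
    P'.lieDer (w s) (v Y) = 0 := by
  induction Y using ExteriorAlgebra.induction with
  | algebraMap r => simp [h.v_scalar, h.w_p]
  | ι t => simp [h.v_ι, h.w_w]
  | mul X Y hX hY => simp only [map_mul, lieDer_mul, hX, hY, mul_zero, zero_mul, add_zero]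
  | add X Y hX hY => simp only [map_add, hX, hY, add_zero]

/-- The derivation `£_(w s)` kills the image of `v`, so in `Q (X ∧ Y)` it sees only the `Q` factors.
Both sides then obey the same Leibniz rule and agree on generators by `w_δ` and `w_q`. -/
theorem lieDer_w_Q (h : LiftData P P' Φ v Q p δ m w q) (s : N) (Y : ExteriorAlgebra R N) :
    P'.lieDer (w s) (Q Y) = v (twistedLie P Φ s Y) := by
  induction Y using ExteriorAlgebra.induction with
  | algebraMap r => simp [h.Q_scalar, h.w_δ, twistedLie_algebraMap, h.v_scalar]
  | ι t =>
    rw [twistedLie_ι, h.Q_ι, lieDer_ι, h.w_q]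
    simp only [map_sub, map_add, map_smul, h.v_smul, h.v_ι]
  | mul X Y hX hY =>
    simp only [h.Q_mul, map_add, map_mul, lieDer_mul, hX, hY, h.lieDer_w_v, twistedLie_mul]
    simp [add_comm]
  | add X Y hX hY => simp only [map_add, hX, hY, twistedLie_add]

theorem lieDer_q_v (h : LiftData P P' Φ v Q p δ m w q) (s : N) (Y : ExteriorAlgebra R N) :
    P'.lieDer (q s) (v Y) = v (twistedLie P Φ s Y) := by
  induction Y using ExteriorAlgebra.induction with
  | algebraMap r => simp [h.q_p, twistedLie_algebraMap, h.v_scalar]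
  | ι t =>
    rw [twistedLie_ι, h.v_ι, lieDer_ι, P'.bracket_skew, h.w_q, P.bracket_skew t s]
    simp only [map_sub, map_add, map_smul, map_neg, h.v_smul, h.v_ι]
    abel
  | mul X Y hX hY => simp only [map_add, map_mul, lieDer_mul, hX, hY, twistedLie_mul]
  | add X Y hX hY => simp only [map_add, hX, hY, twistedLie_add]

/-- The term with `q s` has to be a derivation along `v` for the induction to close. It is one for
the same reason as `∇ ∧ (i_Φ X)^v`: the odd element `q s` absorbs the sign of the contraction. -/
theorem lieDer_q_Q (h : LiftData P P' Φ v Q p δ m w q) (s : N) (Y : ExteriorAlgebra R N) :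
    P'.lieDer (q s) (Q Y) = Q (twistedLie P Φ s Y) + p (Φ s) • Q Y
      - ExteriorAlgebra.ι R' (q s) * v (contr Φ Y) - m • v (twistedLie P Φ s Y) := by
  induction Y using ExteriorAlgebra.induction with
  | algebraMap r =>
    simp [h.Q_scalar, h.q_δ, twistedLie_algebraMap, h.v_scalar, Algebra.smul_def]
  | ι t =>
    rw [twistedLie_ι, h.Q_ι, lieDer_ι, h.q_q, contr_ι, h.v_scalar, ← Algebra.commutes,
      ← Algebra.smul_def]
    simp only [map_sub, map_add, map_smul, h.v_smul, h.Q_smul, h.v_ι, h.Q_ι]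
    abel
  | mul X Y hX hY =>
    have h1 := ι_mul_eq (q s) (v (parity X))
    rw [h.parity_v, parity_parity] at h1
    have h2 := ι_mul_eq (q s) (v X)
    simp only [h.Q_mul, map_add, map_mul, lieDer_mul, hX, hY, twistedLie_mul, h.lieDer_q_v,
      contr_mul]
    simp only [smul_add, add_mul, sub_mul, mul_add, mul_sub, smul_mul_assoc, mul_smul_comm,
      ← mul_assoc, h1]
    abel
  | add X Y hX hY => simp only [map_add, hX, hY, twistedLie_add, smul_add, mul_add]; abel

/-- The bracket `[X, Y]^Φ + X ∧ i_Φ Y`, a derivation in `X`. -/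
noncomputable def derBracket (P : AnchoredBracket R N) (Φ : Module.Dual R N)
    (X Y : ExteriorAlgebra R N) : ExteriorAlgebra R N :=
  P.schouten X Y + degDer X * contr Φ Y - parity (contr Φ X) * degOp Y

/-- What keeps `[X, Y]^Φ` from being a derivation in `X` is the `-1` in `degOp X`. With the exterior
degree in its place, each summand obeys the Leibniz rule with the same sign: `i_Φ Y` is moved past
`X'` by `mul_contr`, and `degOp Y` has the parity of `Y`. -/
theorem derBracket_mul {ε : Bool} {Y : ExteriorAlgebra R N} (hY : HasParity ε Y)
    (X X' : ExteriorAlgebra R N) : derBracket P Φ (X * X') Y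
      = X * derBracket P Φ X' Y + derBracket P Φ X Y * signAut ε X' := by
  have h1 := hY.mul_contr Φ X'
  have h2 := hY.degOp.parity_mul X'
  simp only [derBracket, P.schouten_mul hY, degDer_mul, contr_mul, map_add, map_mul, parity_parity,
    mul_add, add_mul, mul_sub, sub_mul, mul_assoc, h1, h2]
  abel

theorem derBracket_add (X X' Y : ExteriorAlgebra R N) :
    derBracket P Φ (X + X') Y = derBracket P Φ X Y + derBracket P Φ X' Y := by
  simp only [derBracket, schouten_add_left, map_add, add_mul]; abel

theorem derBracket_algebraMap (f : R) (Y : ExteriorAlgebra R N) :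
    derBracket P Φ (algebraMap R _ f) Y = -contr (P.d₀ f) Y := by
  simp [derBracket, schouten_algebraMap]

theorem derBracket_ι (s : N) (Y : ExteriorAlgebra R N) :
    derBracket P Φ (ExteriorAlgebra.ι R s) Y = twistedLie P Φ s Y + Φ s • Y := by
  simp [derBracket, schouten_ι, twistedLie, parity, degOp_eq, smul_sub, ← Algebra.smul_def]
  abel

theorem hasParity_Q_add (h : LiftData P P' Φ v Q p δ m w q) {ε : Bool} {Y : ExteriorAlgebra R N}
    (hY : HasParity ε Y) : HasParity ε (Q Y + m • v Y) := by
  unfold HasParity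
  rw [map_add, map_smul, h.parity_Q, h.parity_v, show parity Y = _ from hY]
  cases ε
  · simp; abel
  · simp

/-- Both sides satisfy the sign-twisted Leibniz rule in `X`, so functions and sections suffice. On a
section the term `Φ s • Y` of `derBracket` comes from differentiating the coefficient `m` along `w
s`. -/
theorem schouten_v (h : LiftData P P' Φ v Q p δ m w q) {ε : Bool} {Y : ExteriorAlgebra R N}
    (hY : HasParity ε Y) (X : ExteriorAlgebra R N) :
    P'.schouten (v X) (Q Y + m • v Y) = v (derBracket P Φ X Y) := by
  induction X using ExteriorAlgebra.induction with
  | algebraMap f =>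
    rw [h.v_scalar, schouten_algebraMap, map_add, map_smul, h.contr_p_Q, h.contr_p_v, smul_zero,
      add_zero, derBracket_algebraMap, map_neg]
  | ι s =>
    rw [h.v_ι, schouten_ι, map_add, Algebra.smul_def, lieDer_mul, h.lieDer_w_Q, h.lieDer_w_v,
      lieDer_algebraMap, h.w_m, derBracket_ι, map_add, h.v_smul, mul_zero, zero_add,
      Algebra.smul_def]
  | mul X X' hX hX' =>
    rw [map_mul, P'.schouten_mul (h.hasParity_Q_add hY), hX, hX', derBracket_mul hY, map_add,
      map_mul, map_mul, h.signAut_v]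
  | add X X' hX hX' => rw [map_add, schouten_add_left, hX, hX', derBracket_add, map_add]

/-- The same induction, but `Q (X ∧ X')` mixes `Q` and `v`, so the product step also uses
`schouten_v`. The extra term `Q X ∧ v (i_Φ Y)` comes from `contr_Q` on functions and from
`lieDer_q_Q` on sections. -/
theorem schouten_Q (h : LiftData P P' Φ v Q p δ m w q) {ε : Bool} {Y : ExteriorAlgebra R N}
    (hY : HasParity ε Y) (X : ExteriorAlgebra R N) :
    P'.schouten (Q X) (Q Y + m • v Y) = Q (derBracket P Φ X Y) - Q X * v (contr Φ Y) := by
  induction X using ExteriorAlgebra.induction with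
  | algebraMap f =>
    rw [h.Q_scalar, schouten_algebraMap, map_add, map_smul,
      h.contr_Q (μ := P.d₀ f) (h.w_δ · f) (h.q_δ · f),
      h.contr_v (μ := P.d₀ f) (h.w_δ · f), derBracket_algebraMap, map_neg, ← Algebra.smul_def]
    abel
  | ι s =>
    rw [h.Q_ι, schouten_ι, map_add, Algebra.smul_def, lieDer_mul, h.lieDer_q_Q, h.lieDer_q_v,
      lieDer_algebraMap, h.q_m, derBracket_ι, map_add, h.Q_smul]
    simp only [Algebra.smul_def]
    abel
  | mul X X' hX hX' =>
    have h1 : v X' * v (contr Φ Y) = v (contr Φ Y) * v (signAut ε X') := by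
      rw [← map_mul, hY.mul_contr, map_mul]
    simp only [h.Q_mul, schouten_add_left, P'.schouten_mul (h.hasParity_Q_add hY), hX, hX',
      derBracket_mul hY, map_add, h.signAut_v, h.signAut_Q, h.schouten_v hY, mul_add, add_mul,
      mul_sub, sub_mul, mul_assoc, h1]
    abel
  | add X X' hX hX' =>
    rw [map_add, schouten_add_left, hX, hX', derBracket_add, map_add, add_mul]
    abel

/-- Expand `m v(X)` by the Leibniz rule, with `m` as an element of degree zero. The new term is `[m,
Y^c_Φ]`, equal to `-(i_Φ Y)^c_Φ`. Combined with the extra term of `schouten_Q`, it is exactly the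
lift of `-X ∧ i_Φ Y`, the difference between `[X, Y]^Φ` and `derBracket`. -/
theorem schouten_lift_of_hasParity (h : LiftData P P' Φ v Q p δ m w q) {ε : Bool}
    {Y : ExteriorAlgebra R N} (hY : HasParity ε Y) (X : ExteriorAlgebra R N) :
    P'.schouten (Q X + m • v X) (Q Y + m • v Y)
      = Q (P.schoutenJacobi Φ X Y) + m • v (P.schoutenJacobi Φ X Y) := by
  have h0 : P.schoutenJacobi Φ X Y = derBracket P Φ X Y - X * contr Φ Y := by
    rw [schoutenJacobi, derBracket, degOp_eq, sub_mul]; abel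
  have hw : ∀ s, P'.anchor (w s) m = p (Φ s) := h.w_m
  -- This is `q_m` in the shape required by `contr_Q`: for `k = m` the two added terms cancel.
  have hq : ∀ s, P'.anchor (q s) m = δ (Φ s) + p (Φ s) * m - m * p (Φ s) := fun s => by
    rw [h.q_m]; ring
  have h1 : v X * Q (contr Φ Y) = Q (contr Φ Y) * v (signAut ε X) := by
    have h3 : parity (Q (contr Φ Y)) = -Q (contr Φ (parity Y)) := by
      rw [h.parity_Q, parity_contr, map_neg]
    rw [show parity Y = _ from hY] at h3
    cases ε
    · exact mul_eq_mul_of_even _ (by simpa using h3)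
    · have h4 := parity_mul_eq_mul_of_odd (parity (v X)) h3
      rwa [parity_parity, h.parity_v] at h4
  have h2 : v X * v (contr Φ Y) = v (contr Φ Y) * v (signAut ε X) := by
    rw [← map_mul, hY.mul_contr, map_mul]
  rw [schouten_add_left, h.schouten_Q hY, Algebra.smul_def m (v X),
    P'.schouten_mul (h.hasParity_Q_add hY), h.schouten_v hY, schouten_algebraMap, h0, map_add,
    map_smul, h.contr_Q hw hq, h.contr_v hw, h.signAut_v]
  simp only [map_sub, h.Q_mul, map_mul, h1, h2, neg_mul, add_mul, sub_mul, smul_sub,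
    ← Algebra.smul_def, smul_mul_assoc]
  abel

theorem schouten_lift (h : LiftData P P' Φ v Q p δ m w q) (X Y : ExteriorAlgebra R N) :
    P'.schouten (Q X + m • v X) (Q Y + m • v Y)
      = Q (P.schoutenJacobi Φ X Y) + m • v (P.schoutenJacobi Φ X Y) := by
  have ho : HasParity false (oddPart Y) := parity_oddPart Y
  have he : HasParity true (evenPart Y) := parity_evenPart Y
  have h1 : P.schoutenJacobi Φ X (oddPart Y + evenPart Y)
      = P.schoutenJacobi Φ X (oddPart Y) + P.schoutenJacobi Φ X (evenPart Y) := by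
    simp only [schoutenJacobi, P.schouten_add_right_of_parity X ho he, map_add, mul_add]
    abel
  have h2 : Q (oddPart Y + evenPart Y) + m • v (oddPart Y + evenPart Y)
      = (Q (oddPart Y) + m • v (oddPart Y)) + (Q (evenPart Y) + m • v (evenPart Y)) := by
    simp only [map_add, smul_add]; abel
  rw [← oddPart_add_evenPart Y, h1, h2,
    P'.schouten_add_right_of_parity _ (h.hasParity_Q_add ho) (h.hasParity_Q_add he),
    h.schouten_lift_of_hasParity ho, h.schouten_lift_of_hasParity he]
  simp only [map_add, smul_add]
  abel

end LiftData
end Lift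
end Grassmann

/-! ### The anchor as a homomorphism, and separation of points of the total space -/

namespace Algebroid

open Grassmann

variable {E H M F : Type*} [NormedAddCommGroup E] [NormedSpace ℝ E]
  [TopologicalSpace H] {I : ModelWithCorners ℝ E H} [TopologicalSpace M] [ChartedSpace H M]
  [NormedAddCommGroup F] [NormedSpace ℝ F] {V : M → Type*}
  [TopologicalSpace (TotalSpace F V)] [∀ x, TopologicalSpace (V x)] [FiberBundle F V]
  [∀ x, AddCommGroup (V x)] [∀ x, Module ℝ (V x)] [VectorBundle ℝ F V] [IsManifold I ∞ M]
  [FiniteDimensional ℝ E] [T2Space M] [FiniteDimensional ℝ F] [ContMDiffVectorBundle ∞ F V I]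

theorem VF.toDer_apply {E H M : Type*} [NormedAddCommGroup E] [NormedSpace ℝ E]
    [TopologicalSpace H] {I : ModelWithCorners ℝ E H} [TopologicalSpace M] [ChartedSpace H M]
    [IsManifold I ∞ M] (X : VF I M) (f : C^∞⟮I, M; 𝓘(ℝ, ℝ), ℝ⟯) : VF.toDer X f = X.act f := rfl

/-- The anchor of a Lie algebroid is a homomorphism of brackets, as a consequence of the Jacobi
identity and the Leibniz rule. -/
theorem LieAlgebroid.anchor_bracket_act (A : LieAlgebroid I F V) (s t : Cₛ^∞⟮I; F, V⟯)
    (f : C^∞⟮I, M; 𝓘(ℝ, ℝ), ℝ⟯) : (A.anchor (A.bracket s t)).act f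
      = (A.anchor s).act ((A.anchor t).act f) - (A.anchor t).act ((A.anchor s).act f) := by
  set g := (A.anchor (A.bracket s t)).act f
    - ((A.anchor s).act ((A.anchor t).act f) - (A.anchor t).act ((A.anchor s).act f)) with hg
  -- Expand the Jacobi identity for `s`, `t`, `f u` by the Leibniz rule. Everything cancels against
  -- the Jacobi identity for `s`, `t`, `u` except the defect `g` times `u`.
  have key (u : Cₛ^∞⟮I; F, V⟯) : g • u = 0 := by
    have h := A.jacobi s t (f • u)
    rw [A.leibniz t, A.leibniz s u, A.leibniz _ u f, map_add, map_add, A.leibniz, A.leibniz,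
      A.leibniz, A.leibniz, A.jacobi s t u, smul_add] at h
    rw [hg, sub_smul, sub_smul, ← neg_eq_zero, ← sub_eq_zero.2 h]
    abel
  refine sub_eq_zero.1 ?_
  -- In rank zero no section detects `g`, but then `s` and `t` vanish and both sides are zero. In
  -- positive rank some section is nonzero at any given point, which forces `g = 0` there.
  by_cases hF : ∀ w : F, w = 0
  · have h0 (u : Cₛ^∞⟮I; F, V⟯) : u = 0 := ContMDiffSection.ext fun x =>
      triv_inj (mem_baseSet_trivializationAt F V x) ((hF _).trans (hF _).symm)
    rw [h0 (A.bracket s t), h0 s, h0 t, map_zero]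
    simp only [← VF.toDer_apply, map_zero, Derivation.zero_apply, sub_self]
  · obtain ⟨w, hw⟩ := not_forall.1 hF
    change g = 0
    ext x
    have hx := mem_baseSet_trivializationAt F V x
    obtain ⟨u, hu⟩ := exists_section_through (I := I)
      (⟨x, (Trivialization.linearEquivAt ℝ (trivializationAt F V x) x hx).symm w⟩
        : TotalSpace F V)
    have h1 : g x • u x = 0 := congrArg (fun u => u x) (key u)
    refine (smul_eq_zero.1 h1).resolve_right fun h2 => hw ?_
    exact (LinearEquiv.map_eq_zero_iff _).1 (hu.symm.trans h2)

/-- Points over different base points are separated in the base, and points of one fibre in a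
trivialization. This makes `anchor_bracket` available for the tangent bundle of the total space,
where cutoff functions need the Hausdorff property. -/
theorem t2Space_totalSpace {M F : Type*} [TopologicalSpace M] [NormedAddCommGroup F] {V : M → Type*}
    [TopologicalSpace (TotalSpace F V)] [∀ x, TopologicalSpace (V x)] [FiberBundle F V]
    [T2Space M] : T2Space (TotalSpace F V) := by
  refine ⟨fun q q' hqq => ?_⟩
  by_cases h : q.proj = q'.proj
  · set e := trivializationAt F V q.proj
    have hq : q ∈ e.source := e.mem_source.2 (mem_baseSet_trivializationAt F V q.proj)
    have hq' : q' ∈ e.source := e.mem_source.2 (h ▸ mem_baseSet_trivializationAt F V q.proj)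
    have hne : e q ≠ e q' := fun h => hqq (e.injOn hq hq' h)
    obtain ⟨U, U', hU, hU', hqU, hqU', hd⟩ := t2_separation hne
    exact ⟨_, _, e.continuousOn.isOpen_inter_preimage e.open_source hU,
      e.continuousOn.isOpen_inter_preimage e.open_source hU', ⟨hq, hqU⟩, ⟨hq', hqU'⟩,
      (hd.preimage e).mono inter_subset_right inter_subset_right⟩
  · obtain ⟨U, U', hU, hU', hqU, hqU', hd⟩ := t2_separation h
    have hc := FiberBundle.continuous_proj F V
    exact ⟨_, _, hU.preimage hc, hU'.preimage hc, hqU, hqU', hd.preimage _⟩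

/-! ### Action of vertical, Euler and complete lifts on functions -/

theorem mvfderiv_vert (g : C^∞⟮I.prod 𝓘(ℝ, F), TotalSpace F V; 𝓘(ℝ, ℝ), ℝ⟯)
    (q : TotalSpace F V) (w : V q.proj) {a : ℝ}
    (h : HasDerivAt (fun τ : ℝ => g ⟨q.proj, q.2 + τ • w⟩) a 0) :
    mvfderiv (I.prod 𝓘(ℝ, F)) g q (vert I q w) = a := by
  have hc : MDifferentiableAt 𝓘(ℝ, ℝ) (I.prod 𝓘(ℝ, F))
      -- In a trivialization the curve is an affine line in one fibre, hence differentiable.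
      (fun τ : ℝ => (⟨q.proj, q.2 + τ • w⟩ : TotalSpace F V)) 0 := by
    set e := trivializationAt F V q.proj
    have hq : q.proj ∈ e.baseSet := mem_baseSet_trivializationAt F V q.proj
    have h1 : (fun τ : ℝ => (⟨q.proj, q.2 + τ • w⟩ : TotalSpace F V))
        = e.toOpenPartialHomeomorph.symm ∘
          fun τ : ℝ => (q.proj, (e q).2 + τ • (e ⟨q.proj, w⟩).2) := by
      funext τ
      have h1 : e ⟨q.proj, q.2 + τ • w⟩ = (q.proj, (e q).2 + τ • (e ⟨q.proj, w⟩).2) := by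
        refine Prod.ext (e.coe_fst' hq) ?_
        rw [triv_add hq, triv_smul hq]
      have h2 := e.toOpenPartialHomeomorph.left_inv
        (e.mem_source.2 (show (⟨q.proj, q.2 + τ • w⟩ : TotalSpace F V).proj ∈ e.baseSet from hq))
      exact h2.symm.trans (congrArg e.toOpenPartialHomeomorph.symm h1)
    rw [h1]
    have hG : MDifferentiableAt (I.prod 𝓘(ℝ, F)) (I.prod 𝓘(ℝ, F)) e.toOpenPartialHomeomorph.symm
        (q.proj, (e q).2 + (0 : ℝ) • (e ⟨q.proj, w⟩).2) := mdiff_symm (I := I) e hq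
    refine hG.comp (0 : ℝ) ?_
    refine mdifferentiableAt_const.prodMk ?_
    refine DifferentiableAt.mdifferentiableAt ?_
    fun_prop
  have h0 : (⟨q.proj, q.2 + (0 : ℝ) • w⟩ : TotalSpace F V) = q := by rw [zero_smul, add_zero]
  have h1 := mvfderiv_comp_apply_of_eq (0 : ℝ) (g.mdifferentiableAt (x := q)) hc h0 (1 : ℝ)
  rw [h0] at h1
  refine h1.symm.trans ?_
  have h2 := h.hasFDerivAt.hasMFDerivAt.mfderiv
  exact (congrArg (fun L : ℝ →L[ℝ] ℝ => L 1) h2).trans (by simp)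

theorem mvfderiv_sectionTangent (g : C^∞⟮I.prod 𝓘(ℝ, F), TotalSpace F V; 𝓘(ℝ, ℝ), ℝ⟯)
    (q : TotalSpace F V) (w : TangentSpace I q.proj) :
    mvfderiv (I.prod 𝓘(ℝ, F)) g q (sectionTangent q w)
      = mvfderiv I (fun x => g ⟨x, sectionThrough I q x⟩) q.proj w := by
  have h0 : (⟨q.proj, sectionThrough I q q.proj⟩ : TotalSpace F V) = q := by
    rw [sectionThrough_apply]
  have hs : MDifferentiableAt I (I.prod 𝓘(ℝ, F))
      (fun x => TotalSpace.mk' F x (sectionThrough I q x)) q.proj :=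
    (sectionThrough I q).contMDiff.contMDiffAt.mdifferentiableAt (by simp)
  have h1 := mvfderiv_comp_apply_of_eq q.proj (g.mdifferentiableAt (x := q)) hs h0 w
  refine (h1.trans ?_).symm
  rw [show TotalSpace.mk' F q.proj (sectionThrough I q q.proj) = q from h0]
  rfl

theorem linFun_line (μ : Form I F V) (q : TotalSpace F V) (s : Cₛ^∞⟮I; F, V⟯) (τ : ℝ) :
    linFun μ ⟨q.proj, q.2 + τ • s q.proj⟩ = linFun μ q + τ * μ s q.proj := by
  set c : C^∞⟮I, M; 𝓘(ℝ, ℝ), ℝ⟯ := ContMDiffMap.const τ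
  have h : (sectionThrough I q + c • s) q.proj = q.2 + τ • s q.proj := by
    rw [← sectionThrough_apply (I := I) q]; rfl
  rw [linFun_apply μ _ _ h, map_add, map_smul]
  rfl

theorem vertSection_pullback (s : Cₛ^∞⟮I; F, V⟯) (f : C^∞⟮I, M; 𝓘(ℝ, ℝ), ℝ⟯) :
    (vertSection s).act (pullback F V f) = 0 := by
  ext q
  exact mvfderiv_vert _ q _ (hasDerivAt_const 0 (f q.proj))

theorem euler_pullback (f : C^∞⟮I, M; 𝓘(ℝ, ℝ), ℝ⟯) :
    (euler : VF (I.prod 𝓘(ℝ, F)) (TotalSpace F V)).act (pullback F V f) = 0 := by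
  ext q
  exact mvfderiv_vert _ q _ (hasDerivAt_const 0 (f q.proj))

theorem mvfderiv_linFun_vert (μ : Form I F V) (q : TotalSpace F V) (s : Cₛ^∞⟮I; F, V⟯) :
    mvfderiv (I.prod 𝓘(ℝ, F)) (linFun μ) q (vert I q (s q.proj)) = μ s q.proj := by
  refine mvfderiv_vert _ q _ ?_
  simp only [linFun_line]
  simpa using ((hasDerivAt_id (0 : ℝ)).mul_const (μ s q.proj)).const_add (linFun μ q)

theorem vertSection_linFun (s : Cₛ^∞⟮I; F, V⟯) (μ : Form I F V) :
    (vertSection s).act (linFun μ) = pullback F V (μ s) := by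
  ext q
  exact mvfderiv_linFun_vert μ q s

/-- At `q` the Euler field is the vertical vector given by the value of any section through `q`. -/
theorem euler_linFun (μ : Form I F V) :
    (euler : VF (I.prod 𝓘(ℝ, F)) (TotalSpace F V)).act (linFun μ) = linFun μ := by
  ext q
  have h := mvfderiv_linFun_vert μ q (sectionThrough I q)
  rw [sectionThrough_apply] at h
  exact h

theorem completeSection_pullback (A : LieAlgebroid I F V) (s : Cₛ^∞⟮I; F, V⟯)
    (f : C^∞⟮I, M; 𝓘(ℝ, ℝ), ℝ⟯) :
    (completeSection A s).act (pullback F V f) = pullback F V ((A.anchor s).act f) := by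
  ext q
  refine (map_sub (mvfderiv (I.prod 𝓘(ℝ, F)) (pullback F V f) q) _ _).trans ?_
  rw [mvfderiv_sectionTangent, mvfderiv_vert _ q _ (hasDerivAt_const 0 (f q.proj)), sub_zero]
  rfl

/-- Along a section `t` through `q` the function `ι_μ` restricts to `μ t`. The two parts of the
complete lift at `q` therefore contribute `a(s)(μ t)` and `-μ [s, t]`, whose sum is `(£_s μ) t`. -/
theorem completeSection_linFun (A : LieAlgebroid I F V) (s : Cₛ^∞⟮I; F, V⟯) (μ : Form I F V) :
    (completeSection A s).act (linFun μ) = linFun (A.toAnchoredBracket.jacobiLie 0 s μ) := by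
  ext q
  refine (map_sub (mvfderiv (I.prod 𝓘(ℝ, F)) (linFun μ) q) _ _).trans ?_
  have h1 : (fun x => linFun μ ⟨x, sectionThrough I q x⟩) = μ (sectionThrough I q) := by
    funext x
    exact linFun_apply μ _ _ rfl
  rw [mvfderiv_sectionTangent, mvfderiv_linFun_vert, h1]
  have h2 : A.toAnchoredBracket.jacobiLie 0 s μ (sectionThrough I q)
      = (A.anchor s).act (μ (sectionThrough I q)) - μ (A.bracket s (sectionThrough I q)) := by
    rw [AnchoredBracket.jacobiLie_apply, LinearMap.zero_apply, zero_mul, add_zero]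
    rfl
  exact (congrArg (fun f : C^∞⟮I, M; 𝓘(ℝ, ℝ), ℝ⟯ => f q.proj) h2).symm

/-! ### Pull-backs and linear functions determine a vector field -/

theorem contMDiff_cutoff_mul {U : Set M} (hU : IsOpen U) (χ : C^∞⟮I, M; 𝓘(ℝ, ℝ), ℝ⟯)
    (hχ : tsupport χ ⊆ U) {g : M → ℝ} (hg : ContMDiffOn I 𝓘(ℝ, ℝ) ∞ g U) :
    ContMDiff I 𝓘(ℝ, ℝ) ∞ (fun x => χ x * g x) :=
  contMDiff_of_tsupport fun x hx => χ.contMDiff.contMDiffAt.mul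
    (hg.contMDiffAt (hU.mem_nhds (hχ (closure_mono (Function.support_mul_subset_left _ _) hx))))

/-- If `v` were nonzero, some linear functional would detect its image in a chart. The functional
composed with the chart, multiplied by a cutoff equal to 1 near `x`, is a global function with
nonzero derivative along `v`. -/
theorem tangent_eq_zero {x : M} (v : TangentSpace I x)
    (h : ∀ f : C^∞⟮I, M; 𝓘(ℝ, ℝ), ℝ⟯, mvfderiv I f x v = 0) : v = 0 := by
  have hx := mem_extChartAt_source (I := I) x
  have hD := isInvertible_mfderiv_extChartAt (I := I) hx
  obtain ⟨D, hD⟩ := hD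
  refine (D.map_eq_zero_iff).1 ?_
  by_contra hv
  obtain ⟨ℓ, hℓ⟩ := SeparatingDual.exists_ne_zero (R := ℝ) (V := E) hv
  obtain ⟨χ, hχ1, hχ⟩ := exists_cutoff I x ((isOpen_extChartAt_source (I := I) x).mem_nhds hx)
  have hs : ContMDiffOn I 𝓘(ℝ, ℝ) ∞ (ℓ ∘ extChartAt I x) (extChartAt I x).source :=
    ℓ.contMDiff.comp_contMDiffOn (by
      rw [extChartAt_source]; exact contMDiffOn_extChartAt)
  have h1 := h ⟨_, contMDiff_cutoff_mul (isOpen_extChartAt_source x) χ hχ hs⟩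
  have h2 : (fun y => χ y * (ℓ ∘ extChartAt I x) y) =ᶠ[𝓝 x] ℓ ∘ extChartAt I x := by
    filter_upwards [hχ1] with y hy
    rw [hy, one_mul]
  have h3 := (ℓ.hasMFDerivAt.comp x
    (mdifferentiableAt_extChartAt (mem_chart_source H x)).hasMFDerivAt).congr_of_eventuallyEq h2
  rw [← hD] at h3
  exact hℓ ((congrArg (fun L : E →L[ℝ] ℝ => L v) h3.mfderiv).symm.trans h1)

/-- A local constant-coefficient form multiplied by a cutoff. It supplies enough 1-forms to separate
the vectors of a fibre. -/
theorem exists_form (ℓ : F →L[ℝ] ℝ) (p : M) : ∃ μ : Form I F V, ∀ u : Cₛ^∞⟮I; F, V⟯,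
    μ u p = ℓ (trivializationAt F V p ⟨p, u p⟩).2 := by
  set e := trivializationAt F V p
  have hp : p ∈ e.baseSet := mem_baseSet_trivializationAt F V p
  obtain ⟨χ, hχ1, hχ⟩ := exists_cutoff I p (e.open_baseSet.mem_nhds hp)
  have hs (u : Cₛ^∞⟮I; F, V⟯) :
      ContMDiffOn I 𝓘(ℝ, ℝ) ∞ (fun x => ℓ (e ⟨x, u x⟩).2) e.baseSet := fun x hx =>
    (ℓ.contMDiff.contMDiffAt.comp x
      ((e.contMDiffAt_section_iff hx).1 u.contMDiff.contMDiffAt)).contMDiffWithinAt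
  have hz {x : M} (hx : x ∉ e.baseSet) : χ x = 0 :=
    image_eq_zero_of_notMem_tsupport fun h => hx (hχ h)
  refine ⟨
    { toFun := fun u => ⟨_, contMDiff_cutoff_mul e.open_baseSet χ hχ (hs u)⟩
      map_add' := fun u u' => by
        ext x
        change χ x * ℓ (e ⟨x, u x + u' x⟩).2
          = χ x * ℓ (e ⟨x, u x⟩).2 + χ x * ℓ (e ⟨x, u' x⟩).2
        by_cases hx : x ∈ e.baseSet
        · rw [triv_add hx, map_add, mul_add]
        · simp [hz hx]
      map_smul' := fun f u => by
        ext x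
        change χ x * ℓ (e ⟨x, f x • u x⟩).2 = f x * (χ x * ℓ (e ⟨x, u x⟩).2)
        by_cases hx : x ∈ e.baseSet
        · rw [triv_smul hx, map_smul, smul_eq_mul, mul_left_comm]
        · simp [hz hx] }, fun u => ?_⟩
  change χ p * ℓ (e ⟨p, u p⟩).2 = _
  rw [hχ1.self_of_nhds, one_mul]

/-- Vector fields on the total space of a bundle are determined by their action on pull-backs and
on fibrewise linear functions. -/
theorem VF.eq_of_act {W W' : VF (I.prod 𝓘(ℝ, F)) (TotalSpace F V)}
    (h1 : ∀ f : C^∞⟮I, M; 𝓘(ℝ, ℝ), ℝ⟯, W.act (pullback F V f) = W'.act (pullback F V f))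
    (h2 : ∀ μ : Form I F V, W.act (linFun μ) = W'.act (linFun μ)) : W = W' := by
  refine ContMDiffSection.ext fun q => sub_eq_zero.1 ?_
  set e := trivializationAt F V q.proj
  have hq : q.proj ∈ e.baseSet := mem_baseSet_trivializationAt F V q.proj
  have h1' (f : C^∞⟮I, M; 𝓘(ℝ, ℝ), ℝ⟯) :
      mvfderiv (I.prod 𝓘(ℝ, F)) (pullback F V f) q (W q - W' q) = 0 := by
    rw [map_sub, sub_eq_zero]
    exact congrArg (fun g => g q) (h1 f)
  have h2' (μ : Form I F V) :
      mvfderiv (I.prod 𝓘(ℝ, F)) (linFun μ) q (W q - W' q) = 0 := by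
    rw [map_sub, sub_eq_zero]
    exact congrArg (fun g => g q) (h2 μ)
  generalize W q - W' q = Z at h1' h2'
  have hG : MDifferentiableAt (I.prod 𝓘(ℝ, F)) (I.prod 𝓘(ℝ, F)) e.toOpenPartialHomeomorph.symm
      (e q) := mdiff_symm (I := I) e ((e.coe_fst' hq).symm ▸ hq)
  have hsq : e.toOpenPartialHomeomorph.symm (e q) = q :=
    e.toOpenPartialHomeomorph.left_inv (e.mem_source.2 hq)
  -- Every tangent vector has components in the trivialization, since the derivative of the inverse
  -- trivialization after that of the trivialization is the identity.
  obtain ⟨v, w, rfl⟩ : ∃ (v : E) (w : F), tri I e (e q) v w = Z := by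
    have he : MDifferentiableAt (I.prod 𝓘(ℝ, F)) (I.prod 𝓘(ℝ, F)) e q :=
      ((e.contMDiffOn (IB := I) (n := ∞)).contMDiffAt
        (e.open_source.mem_nhds (e.mem_source.2 hq))).mdifferentiableAt (by simp)
    have hid : e.toOpenPartialHomeomorph.symm ∘ e =ᶠ[𝓝 q] id := by
      filter_upwards [e.open_source.mem_nhds (e.mem_source.2 hq)] with y hy
      exact e.toOpenPartialHomeomorph.left_inv hy
    have hc := ((hG.hasMFDerivAt.comp q he.hasMFDerivAt).congr_of_eventuallyEq hid.symm).mfderiv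
    set y : E × F := mfderiv (I.prod 𝓘(ℝ, F)) (I.prod 𝓘(ℝ, F)) e q Z
    refine ⟨y.1, y.2, ?_⟩
    rw [mfderiv_id] at hc
    exact (congrArg (fun L : E × F →L[ℝ] E × F => L Z) hc).symm
  -- In the trivialization a pull-back depends on the base coordinate only, so pull-backs detect
  -- exactly the base component.
  have hv : v = 0 := by
    refine tangent_eq_zero (I := I) (x := q.proj) v fun f => ?_
    refine Eq.trans ?_ (h1' f)
    have hc := mvfderiv_comp_apply_of_eq (e q) ((pullback F V f).mdifferentiableAt (x := q)) hG hsq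
      ((v, w) : E × F)
    rw [hsq] at hc
    refine Eq.trans ?_ hc
    have hf : (pullback F V f) ∘ e.toOpenPartialHomeomorph.symm =ᶠ[𝓝 (e q)] f ∘ Prod.fst := by
      filter_upwards [e.open_target.mem_nhds (e.map_source (e.mem_source.2 hq))] with z hz
      exact congrArg f (e.proj_symm_apply hz)
    have h3 := (f.mdifferentiableAt (x := (e q).1)).hasMFDerivAt.comp (e q)
      (hasMFDerivAt_fst (I := I) (I' := 𝓘(ℝ, F)) (e q))
    have h4 := (h3.congr_of_eventuallyEq hf).mfderiv
    rw [show (e q).1 = q.proj from e.coe_fst' hq] at h4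
    exact (congrArg (fun L : E × F →L[ℝ] ℝ => L (v, w)) h4).symm
  subst hv
  -- The remaining vector is vertical, and `ι_μ` differentiated along it gives the value of `μ` on
  -- the corresponding fibre element.
  have hw : w = 0 := by
    by_contra hw
    obtain ⟨ℓ, hℓ⟩ := SeparatingDual.exists_ne_zero (R := ℝ) (V := F) hw
    obtain ⟨μ, hμ⟩ := exists_form (I := I) (V := V) ℓ q.proj
    set c : V q.proj := (e.linearEquivAt ℝ q.proj hq).symm w
    have hc : (e ⟨q.proj, c⟩).2 = w := (e.linearEquivAt ℝ q.proj hq).apply_symm_apply w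
    obtain ⟨u, hu⟩ := exists_section_through (I := I) (⟨q.proj, c⟩ : TotalSpace F V)
    have h3 := mvfderiv_linFun_vert μ q u
    rw [hμ, show u q.proj = c from hu, vert_eq hq, hc] at h3
    exact hℓ (h3.symm.trans (h2' μ))
  subst hw
  exact map_zero (mfderiv (I.prod 𝓘(ℝ, F)) (I.prod 𝓘(ℝ, F)) e.toOpenPartialHomeomorph.symm (e q))

/-! ### Brackets of the lifted vector fields -/

open AnchoredBracket

variable (J : JacobiAlgebroid I F V)

variable (I F V) in
/-- The bracket and the anchor of the tangent bundle of the total space of a vector bundle. -/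
noncomputable abbrev totalBracket : AnchoredBracket
    C^∞⟮I.prod 𝓘(ℝ, F), TotalSpace F V; 𝓘(ℝ, ℝ), ℝ⟯ (VF (I.prod 𝓘(ℝ, F)) (TotalSpace F V)) :=
  (tangentAlgebroid (I := I.prod 𝓘(ℝ, F)) (M := TotalSpace F V)).toAnchoredBracket

theorem toAnchoredBracket_anchor (A : LieAlgebroid I F V) (s : Cₛ^∞⟮I; F, V⟯)
    (f : C^∞⟮I, M; 𝓘(ℝ, ℝ), ℝ⟯) : A.toAnchoredBracket.anchor s f = (A.anchor s).act f := rfl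

theorem tangent_anchor {E H M : Type*} [NormedAddCommGroup E] [NormedSpace ℝ E]
    [FiniteDimensional ℝ E] [TopologicalSpace H] {I : ModelWithCorners ℝ E H} [TopologicalSpace M]
    [ChartedSpace H M] [IsManifold I ∞ M] (X : VF I M) (f : C^∞⟮I, M; 𝓘(ℝ, ℝ), ℝ⟯) :
    (tangentAlgebroid (I := I) (M := M)).toAnchoredBracket.anchor X f = X.act f := rfl

theorem totalBracket_anchor (X : VF (I.prod 𝓘(ℝ, F)) (TotalSpace F V))
    (f : C^∞⟮I.prod 𝓘(ℝ, F), TotalSpace F V; 𝓘(ℝ, ℝ), ℝ⟯) :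
    (totalBracket F I V).anchor X f = X.act f := tangent_anchor X f

theorem eq_of_anchor {W W' : VF (I.prod 𝓘(ℝ, F)) (TotalSpace F V)}
    (h1 : ∀ f : C^∞⟮I, M; 𝓘(ℝ, ℝ), ℝ⟯, (totalBracket F I V).anchor W (pullback F V f)
      = (totalBracket F I V).anchor W' (pullback F V f))
    (h2 : ∀ μ : Form I F V, (totalBracket F I V).anchor W (linFun μ)
      = (totalBracket F I V).anchor W' (linFun μ)) : W = W' := by
  simp only [totalBracket_anchor] at h1 h2
  exact VF.eq_of_act h1 h2

/-- The Poisson lift of a section. -/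
noncomputable def poissonSection :
    Cₛ^∞⟮I; F, V⟯ →+ VF (I.prod 𝓘(ℝ, F)) (TotalSpace F V) :=
  AddMonoidHom.mk' (fun s => completeSection J.toLieAlgebroid s + pullback F V (J.Φ s) • euler)
    (fun s t => by simp only [map_add, add_smul]; abel)

/-- The Poisson lift of sections minus `ι_Φ` times the vertical lift. -/
noncomputable def poissonDerSection :
    Cₛ^∞⟮I; F, V⟯ →+ VF (I.prod 𝓘(ℝ, F)) (TotalSpace F V) :=
  AddMonoidHom.mk' (fun s => poissonSection J s - linFun J.Φ • vertSection s)
    (fun s t => by simp only [map_add, smul_add]; abel)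

/-- The Poisson lift of multisections minus `ι_Φ` times the vertical lift. -/
noncomputable def poissonDer :
    MultiSection I F V →+ MultiVector (I.prod 𝓘(ℝ, F)) (TotalSpace F V) :=
  liftDer (completeLift J.toLieAlgebroid) verticalLift (linFun J.Φ) euler J.Φ

theorem poissonLift_eq (X : MultiSection I F V) :
    poissonLift J X = poissonDer J X + linFun J.Φ • verticalLift X :=
  liftDer_add_smul _ _ _ _ _ X

theorem poissonDer_mul (X Y : MultiSection I F V) : poissonDer J (X * Y)
    = poissonDer J X * verticalLift Y + verticalLift X * poissonDer J Y :=
  liftDer_mul _ _ _ (derExt_mul _) (parity_map verticalLift_algebraMap verticalLift_ι) X Y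

theorem poissonDer_algebraMap (f : C^∞⟮I, M; 𝓘(ℝ, ℝ), ℝ⟯) :
    poissonDer J (algebraMap _ _ f) = algebraMap _ _ (linDiff J.toLieAlgebroid f) :=
  liftDer_algebraMap _ _ _ (derExt_algebraMap _ f)

theorem poissonDer_ι (s : Cₛ^∞⟮I; F, V⟯) :
    poissonDer J (ExteriorAlgebra.ι _ s) = ExteriorAlgebra.ι _ (poissonDerSection J s) :=
  liftDer_ι _ _ _ (derExt_ι _ s) (verticalLift_ι s) (verticalLift_algebraMap _)

theorem linFun_jacobiDiff₀ (f : C^∞⟮I, M; 𝓘(ℝ, ℝ), ℝ⟯) :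
    linFun (J.toAnchoredBracket.jacobiDiff₀ J.Φ f)
      = linDiff J.toLieAlgebroid f + pullback F V f * linFun J.Φ := by
  rw [jacobiDiff₀, linFun_add, linFun_smul]
  rfl

theorem anchor_vertSection_pullback (s : Cₛ^∞⟮I; F, V⟯) (f : C^∞⟮I, M; 𝓘(ℝ, ℝ), ℝ⟯) :
    (totalBracket F I V).anchor (vertSection s) (pullback F V f) = 0 := by
  rw [totalBracket_anchor, vertSection_pullback]

theorem anchor_vertSection_linFun (s : Cₛ^∞⟮I; F, V⟯) (μ : Form I F V) :
    (totalBracket F I V).anchor (vertSection s) (linFun μ) = pullback F V (μ s) := by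
  rw [totalBracket_anchor, vertSection_linFun]

theorem anchor_poissonSection_pullback (s : Cₛ^∞⟮I; F, V⟯) (f : C^∞⟮I, M; 𝓘(ℝ, ℝ), ℝ⟯) :
    (totalBracket F I V).anchor (poissonSection J s) (pullback F V f)
      = pullback F V (J.toAnchoredBracket.anchor s f) := by
  have h1 : (totalBracket F I V).anchor (completeSection J.toLieAlgebroid s) (pullback F V f)
      = pullback F V (J.toAnchoredBracket.anchor s f) := by
    rw [totalBracket_anchor, completeSection_pullback, toAnchoredBracket_anchor]
  have h2 : (totalBracket F I V).anchor euler (pullback F V f) = 0 := by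
    rw [totalBracket_anchor, euler_pullback]
  simp [poissonSection, h1, h2]

/-- On 1-forms `£^Φ_s = £_s + Φ(s)`. The zeroth order term is produced by the Euler field, which
reproduces linear functions. -/
theorem anchor_poissonSection_linFun (s : Cₛ^∞⟮I; F, V⟯) (μ : Form I F V) :
    (totalBracket F I V).anchor (poissonSection J s) (linFun μ)
      = linFun (J.toAnchoredBracket.jacobiLie J.Φ s μ) := by
  have h1 : (totalBracket F I V).anchor (completeSection J.toLieAlgebroid s) (linFun μ)
      = linFun (J.toAnchoredBracket.jacobiLie 0 s μ) := by
    rw [totalBracket_anchor, completeSection_linFun]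
  have h2 : (totalBracket F I V).anchor euler (linFun μ) = linFun μ := by
    rw [totalBracket_anchor, euler_linFun]
  have h3 : J.toAnchoredBracket.jacobiLie J.Φ s μ
      = J.toAnchoredBracket.jacobiLie 0 s μ + J.Φ s • μ := by
    ext1 t
    simp only [LinearMap.add_apply, LinearMap.smul_apply, jacobiLie_apply, LinearMap.zero_apply,
      smul_eq_mul]
    ring
  rw [h3, linFun_add, linFun_smul, ← h1]
  simp [poissonSection, h2]

theorem anchor_bracket (A : LieAlgebroid I F V) (s t : Cₛ^∞⟮I; F, V⟯)
    (f : C^∞⟮I, M; 𝓘(ℝ, ℝ), ℝ⟯) :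
    A.toAnchoredBracket.anchor (A.toAnchoredBracket.bracket s t) f
      = A.toAnchoredBracket.anchor s (A.toAnchoredBracket.anchor t f)
        - A.toAnchoredBracket.anchor t (A.toAnchoredBracket.anchor s f) :=
  A.anchor_bracket_act s t f

theorem bracket_jacobi (A : LieAlgebroid I F V) (s t u : Cₛ^∞⟮I; F, V⟯) :
    A.toAnchoredBracket.bracket (A.toAnchoredBracket.bracket s t) u
      = A.toAnchoredBracket.bracket s (A.toAnchoredBracket.bracket t u)
        - A.toAnchoredBracket.bracket t (A.toAnchoredBracket.bracket s u) :=
  eq_sub_of_add_eq (A.jacobi s t u).symm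

theorem jacobiLie_d₀ (s : Cₛ^∞⟮I; F, V⟯) (f : C^∞⟮I, M; 𝓘(ℝ, ℝ), ℝ⟯) :
    J.toAnchoredBracket.jacobiLie J.Φ s (J.toAnchoredBracket.d₀ f)
      = J.toAnchoredBracket.d₀ (J.toAnchoredBracket.anchor s f)
        + J.Φ s • J.toAnchoredBracket.d₀ f := by
  ext1 t
  have h (s f) : J.toAnchoredBracket.d₀ f s = J.toAnchoredBracket.anchor s f := rfl
  simp only [jacobiLie_apply, LinearMap.add_apply, LinearMap.smul_apply, h, anchor_bracket,
    smul_eq_mul]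
  ring

/-- Closedness in the form `a(s)(Φ t) - Φ [s, t] = a(t)(Φ s)`. -/
theorem jacobiLie_cocycle (s : Cₛ^∞⟮I; F, V⟯) : J.toAnchoredBracket.jacobiLie J.Φ s J.Φ
    = J.toAnchoredBracket.d₀ (J.Φ s) + J.Φ s • J.Φ := by
  ext1 t
  have h (s f) : J.toAnchoredBracket.d₀ f s = J.toAnchoredBracket.anchor s f := rfl
  simp only [jacobiLie_apply, LinearMap.add_apply, LinearMap.smul_apply, h, smul_eq_mul]
  linear_combination J.isCocycle s t

/-- `£^Φ_s` is the operator on 1-forms induced by `t ↦ [s, t]` and `f ↦ a(s)(f) + Φ(s) f`. The first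
represents the bracket by the Jacobi identity. The second does so because the anchor preserves
brackets and `dΦ = 0`. -/
theorem jacobiLie_bracket (s t : Cₛ^∞⟮I; F, V⟯) (μ : Form I F V) :
    J.toAnchoredBracket.jacobiLie J.Φ (J.toAnchoredBracket.bracket s t) μ
      = J.toAnchoredBracket.jacobiLie J.Φ s (J.toAnchoredBracket.jacobiLie J.Φ t μ)
        - J.toAnchoredBracket.jacobiLie J.Φ t (J.toAnchoredBracket.jacobiLie J.Φ s μ) := by
  ext1 u
  simp only [jacobiLie_apply, LinearMap.sub_apply, anchor_bracket, bracket_jacobi, map_sub,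
    map_add, Derivation.leibniz, smul_eq_mul]
  linear_combination (-μ u) * J.isCocycle s t

/-- A vertical lift kills pull-backs and sends linear functions to pull-backs, so any two applied in
succession give zero on both kinds of function. -/
theorem bracket_vertSection_vertSection [T2Space (TotalSpace F V)] (s t : Cₛ^∞⟮I; F, V⟯) :
    (totalBracket F I V).bracket (vertSection s) (vertSection t) = 0 := by
  refine eq_of_anchor (fun f => ?_) (fun μ => ?_)
  · simp [anchor_bracket, anchor_vertSection_pullback]
  · simp [anchor_bracket, anchor_vertSection_pullback, anchor_vertSection_linFun]

theorem bracket_vertSection_poissonSection [T2Space (TotalSpace F V)] (s t : Cₛ^∞⟮I; F, V⟯) :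
    (totalBracket F I V).bracket (vertSection s) (poissonSection J t)
      = vertSection (J.toAnchoredBracket.bracket s t) + pullback F V (J.Φ t) • vertSection s := by
  refine eq_of_anchor (fun f => ?_) (fun μ => ?_)
  · simp [anchor_bracket, anchor_vertSection_pullback, anchor_poissonSection_pullback]
  · simp [anchor_bracket, anchor_vertSection_linFun, anchor_poissonSection_pullback,
      anchor_poissonSection_linFun, jacobiLie_apply, J.toAnchoredBracket.bracket_skew t s]
    ring

theorem bracket_poissonSection_poissonSection [T2Space (TotalSpace F V)]
    (s t : Cₛ^∞⟮I; F, V⟯) :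
    (totalBracket F I V).bracket (poissonSection J s) (poissonSection J t)
      = poissonSection J (J.toAnchoredBracket.bracket s t) := by
  refine eq_of_anchor (fun f => ?_) (fun μ => ?_)
  · simp only [anchor_bracket, anchor_poissonSection_pullback, map_sub]
  · simp only [anchor_bracket, anchor_poissonSection_linFun, jacobiLie_bracket]
    rfl

theorem liftData [T2Space (TotalSpace F V)] :
    LiftData J.toAnchoredBracket (totalBracket F I V) J.Φ verticalLift (poissonDer J)
      (pullback F V) (linDiff J.toLieAlgebroid) (linFun J.Φ) vertSection
      (poissonDerSection J) where
  v_scalar := verticalLift_algebraMap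
  v_ι := verticalLift_ι
  Q_scalar := poissonDer_algebraMap J
  Q_ι := poissonDer_ι J
  Q_mul := poissonDer_mul J
  w_p := anchor_vertSection_pullback
  q_p s f := by
    simp [poissonDerSection, anchor_poissonSection_pullback, anchor_vertSection_pullback]
  w_m s := anchor_vertSection_linFun s J.Φ
  w_δ s f := anchor_vertSection_linFun s _
  q_m s := by
    simp [poissonDerSection, anchor_poissonSection_linFun, anchor_vertSection_linFun,
      jacobiLie_cocycle, linFun_add, linFun_smul, linDiff]
    ring
  q_δ s f := by
    have h : J.toAnchoredBracket.d₀ f s = J.toAnchoredBracket.anchor s f := rfl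
    simp [poissonDerSection, anchor_poissonSection_linFun, anchor_vertSection_linFun,
      jacobiLie_d₀, linFun_add, linFun_smul, linDiff, h]
  w_w := bracket_vertSection_vertSection
  w_q s t := by
    simp only [poissonDerSection, AddMonoidHom.mk'_apply, map_sub, leibniz,
      bracket_vertSection_poissonSection, bracket_vertSection_vertSection,
      anchor_vertSection_linFun, smul_zero, zero_add]
  q_q s t := by
    -- The remaining goals are the bracket with the roles of `s` and `t` exchanged, and the action
    -- of the two Poisson lifts on `ι_Φ`, where the cocycle condition enters.
    refine bracket_sub_smul _ (bracket_poissonSection_poissonSection J s t)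
      (bracket_vertSection_poissonSection J s t) ?_ (bracket_vertSection_vertSection s t)
      (anchor_vertSection_linFun s J.Φ) (anchor_vertSection_linFun t J.Φ) ?_ ?_
    · rw [bracket_vertSection_poissonSection, J.toAnchoredBracket.bracket_skew t s, map_neg]
    · rw [anchor_poissonSection_linFun, jacobiLie_cocycle, linFun_add, linFun_smul]
      rfl
    · rw [anchor_poissonSection_linFun, jacobiLie_cocycle, linFun_add, linFun_smul]
      rfl

end Algebroid

/-! ### The properties of the Poisson lift -/

theorem theorem12 {E H M F : Type*} [NormedAddCommGroup E] [NormedSpace ℝ E]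
    [FiniteDimensional ℝ E] [TopologicalSpace H] {I : ModelWithCorners ℝ E H} [I.Boundaryless]
    [TopologicalSpace M] [ChartedSpace H M] [IsManifold I ∞ M] [T2Space M]
    [SecondCountableTopology M] [NormedAddCommGroup F] [NormedSpace ℝ F] [FiniteDimensional ℝ F]
    {V : M → Type*} [TopologicalSpace (TotalSpace F V)] [∀ x, TopologicalSpace (V x)]
    [FiberBundle F V] [∀ x, AddCommGroup (V x)] [∀ x, Module ℝ (V x)] [VectorBundle ℝ F V]
    [ContMDiffVectorBundle ∞ F V I] (J : Algebroid.JacobiAlgebroid I F V) :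
    (∀ f : C^∞⟮I, M; 𝓘(ℝ, ℝ), ℝ⟯,
      Algebroid.poissonLift J (algebraMap _ (Algebroid.MultiSection I F V) f) =
        algebraMap _ _ (Algebroid.linFun (J.toAnchoredBracket.jacobiDiff₀ J.Φ f))) ∧
    (∀ s : Cₛ^∞⟮I; F, V⟯, ∃ W : Algebroid.VF (I.prod 𝓘(ℝ, F)) (TotalSpace F V),
      Algebroid.poissonLift J (ExteriorAlgebra.ι _ s) = ExteriorAlgebra.ι _ W ∧
        ∀ μ : Algebroid.Form I F V,
          W.act (Algebroid.linFun μ) =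
            Algebroid.linFun (J.toAnchoredBracket.jacobiLie J.Φ s μ)) ∧
    (∀ X Y : Algebroid.MultiSection I F V,
      Algebroid.poissonLift J (X * Y) =
        Algebroid.poissonLift J X * Algebroid.verticalLift Y
          + Algebroid.verticalLift X * Algebroid.poissonLift J Y
          - Algebroid.linFun J.Φ • (Algebroid.verticalLift X * Algebroid.verticalLift Y)) ∧
    (∀ X Y : Algebroid.MultiSection I F V,
      Algebroid.schoutenNijenhuis (Algebroid.poissonLift J X) (Algebroid.poissonLift J Y) =
        Algebroid.poissonLift J (J.toAnchoredBracket.schoutenJacobi J.Φ X Y)) := by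
  have := Algebroid.t2Space_totalSpace (F := F) (V := V)
  have hQ (X : Algebroid.MultiSection I F V) := Algebroid.poissonLift_eq J X
  have hd := Algebroid.liftData J
  refine ⟨fun f => ?_, fun s => ⟨Algebroid.poissonSection J s, ?_, fun μ => ?_⟩, fun X Y => ?_,
    fun X Y => ?_⟩
  · rw [hQ, hd.Q_scalar, hd.v_scalar, Algebra.smul_def, ← map_mul, ← map_add, mul_comm]
    exact congrArg _ (Algebroid.linFun_jacobiDiff₀ J f).symm
  · rw [hQ, hd.Q_ι, hd.v_ι, ← map_smul, ← map_add]
    exact congrArg _ (sub_add_cancel _ _)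
  · rw [← Algebroid.totalBracket_anchor, Algebroid.anchor_poissonSection_linFun]
  -- With the lift written as `Q + m v`, the term `m v(X) v(Y)` occurs once on the left. On the
  -- right it occurs twice and is subtracted once.
  · simp only [hQ, hd.Q_mul, map_mul, mul_add, add_mul, smul_mul_assoc, mul_smul_comm]
    abel
  · simp only [hQ]
    exact hd.schouten_lift X Y
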